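/- Let $G$ be a semisimple Lie group with Lie algebra $\mathfrak g$ and Killing form $B$, and let $P\subset G$ be a parabolic subgroup, i.e. a closed subgroup whose Lie algebra $\mathfrak p\subset\mathfrak g$ is a parabolic subalgebra. Let $\mathfrak p_+\subset\mathfrak p$ be the nilradical of $\mathfrak p$; it is the orthocomplement of $\mathfrak p$ with respect to $B$, so $B$ induces an isomorphism $\mathfrak p_+\cong(\mathfrak g/\mathfrak p)^*$. Let $(p:\mathcal G\to M,\omega)$ be a parabolic geometry of type $(G,P)$, i.e. a smooth principal $P$-bundle endowed with a Cartan connection $\omega\in\Omega^1(\mathcal G,\mathfrak g)$. For a representation $W$ of $P$ put $WM=\mathcal G\times_PW$ and identify $\Gamma(WM)$ with the space $C^\infty(\mathcal G,W)^P$ of smooth $P$-equivariant functions. Let $\mathcal AM=\mathcal G\times_P\mathfrak g$ be the adjoint tractor bundle, and recall that $TM\cong\mathcal G\times_P(\mathfrak g/\mathfrak p)$ and $T^*M\cong\mathcal G\times_P\mathfrak p_+$; let $\Pi:\mathcal AM\to TM$ be the natural projection. The fundamental derivative $D:\Gamma(WM)\to\Gamma(\mathcal A^*M\otimes WM)$ is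 given by letting $D_s\sigma$ be the derivative of $\sigma$ along the $P$-invariant vector field $\omega^{-1}(s)$ on $\mathcal G$, for $s\in\Gamma(\mathcal AM)=C^\infty(\mathcal G,\mathfrak g)^P$. The curved Casimir operator is $\mathcal C=(B\otimes\operatorname{id})\circ D^2:\Gamma(WM)\to\Gamma(WM)$, i.e. the contraction of $D^2\sigma\in\Gamma(\mathcal A^*M\otimes\mathcal A^*M\otimes WM)$ with the inverse form of $B$ on $\mathfrak g^*$. Let $V$ be a finite-dimensional irreducible (real or complex) representation of $G$, write $\bullet$ for the infinitesimal action of $\mathfrak g$ on $V$ and for the induced action of $\mathcal AM$ on $VM$, and let $c_0$ be the scalar by which the Casimir operator $v\mapsto\sum_\ell\xi^\ell\bullet\xi_\ell\bullet v$ acts on $V$, where $\{\xi^\ell\}$ and $\{\xi_\ell\}$ are bases of $\mathfrak g$ which are dual with respect to $B$. Let $\nabla^V:\Gamma(VM)\to\Gamma(T^*M\otimes VM)$ be the canonical tractor connection, characterized by $\nabla^V_{\Pi(s)}\sigma=D_s\sigma+s\bullet\sigma$, and let $\partial^*:T^*M\otimes VM\to VM$ be the Kostant codifferential, i.e. the bundle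 map induced by $\mathfrak p_+\otimes V\to V$, $Z\otimes v\mapsto-Z\bullet v$. Then for every $\sigma\in\Gamma(VM)$, $$\mathcal C(\sigma)=c_0\,\sigma+2\,\partial^*\nabla^V\sigma .$$ -/

import Mathlib

set_option linter.unusedSectionVars false

open scoped Manifold ContDiff TensorProduct

namespace CurvedCasimir

noncomputable section

section LieAlgebraOfGroup

/-- The Lie algebra `𝔤 = T₁G` of a Lie group `G`. The underlying vector space is the tangent space
at the identity, i.e. the model space `E`, whose norm it inherits. -/
def LieAlg (E : Type*) [NormedAddCommGroup E] [NormedSpace ℝ E]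
    (G : Type*) [TopologicalSpace G] [ChartedSpace E G] [Group G] : Type _ :=
  GroupLieAlgebra 𝓘(ℝ, E) G

variable (E : Type*) [NormedAddCommGroup E] [NormedSpace ℝ E]
  (G : Type*) [TopologicalSpace G] [ChartedSpace E G] [Group G]

/-- An element of `𝔤` regarded as a tangent vector at the identity. -/
abbrev LieAlg.tan {E : Type*} [NormedAddCommGroup E] [NormedSpace ℝ E]
    {G : Type*} [TopologicalSpace G] [ChartedSpace E G] [Group G] (X : LieAlg E G) :
    GroupLieAlgebra 𝓘(ℝ, E) G := X

instance : NormedAddCommGroup (LieAlg E G) := inferInstanceAs (NormedAddCommGroup E)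

instance : NormedSpace ℝ (LieAlg E G) := inferInstanceAs (NormedSpace ℝ E)

instance [FiniteDimensional ℝ E] : FiniteDimensional ℝ (LieAlg E G) :=
  inferInstanceAs (FiniteDimensional ℝ E)

theorem lieGroup_three [LieGroup 𝓘(ℝ, E) ∞ G] : LieGroup 𝓘(ℝ, E) (minSmoothness ℝ 3) G := by
  rw [minSmoothness_of_isRCLikeNormedField]
  infer_instance

variable [FiniteDimensional ℝ E] [LieGroup 𝓘(ℝ, E) ∞ G]

/-- The bracket is Mathlib's: the bracket at `1` of left invariant vector fields. -/
instance : LieRing (LieAlg E G) :=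
  haveI := lieGroup_three E G
  haveI : CompleteSpace E := FiniteDimensional.complete ℝ E
  letI r : LieRing (GroupLieAlgebra 𝓘(ℝ, E) G) := inferInstance
  { (inferInstance : NormedAddCommGroup (LieAlg E G)).toAddCommGroup with
    bracket := r.bracket
    add_lie := r.add_lie
    lie_add := r.lie_add
    lie_self := r.lie_self
    leibniz_lie := r.leibniz_lie }

instance : LieAlgebra ℝ (LieAlg E G) :=
  haveI := lieGroup_three E G
  haveI : CompleteSpace E := FiniteDimensional.complete ℝ E
  letI r : LieAlgebra ℝ (GroupLieAlgebra 𝓘(ℝ, E) G) := inferInstance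
  { (inferInstance : NormedSpace ℝ (LieAlg E G)).toModule with
    lie_smul := r.lie_smul }

end LieAlgebraOfGroup

section ChainRule

variable {E₁ E₂ E₃ : Type*} [NormedAddCommGroup E₁] [NormedSpace ℝ E₁] [NormedAddCommGroup E₂]
  [NormedSpace ℝ E₂] [NormedAddCommGroup E₃] [NormedSpace ℝ E₃]
  {M₁ M₂ M₃ : Type*} [TopologicalSpace M₁] [ChartedSpace E₁ M₁] [TopologicalSpace M₂]
  [ChartedSpace E₂ M₂] [TopologicalSpace M₃] [ChartedSpace E₃ M₃]

/-- The derivative as a map of the model spaces. -/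
abbrev modelDeriv (E₁ E₂ : Type*) [NormedAddCommGroup E₁] [NormedSpace ℝ E₁]
    [NormedAddCommGroup E₂] [NormedSpace ℝ E₂] {M₁ M₂ : Type*} [TopologicalSpace M₁]
    [ChartedSpace E₁ M₁] [TopologicalSpace M₂] [ChartedSpace E₂ M₂] (f : M₁ → M₂) (x : M₁) : E₁ →L[ℝ] E₂ := mfderiv 𝓘(ℝ, E₁) 𝓘(ℝ, E₂) f x

theorem mfderiv_chain {f : M₁ → M₂} {k : M₂ → M₃} {x : M₁} {y : M₂}
    (hk : MDifferentiableAt 𝓘(ℝ, E₂) 𝓘(ℝ, E₃) k y)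
    (hf : MDifferentiableAt 𝓘(ℝ, E₁) 𝓘(ℝ, E₂) f x) (hy : f x = y) :
    modelDeriv E₁ E₃ (k ∘ f) x = (modelDeriv E₂ E₃ k y).comp (modelDeriv E₁ E₂ f x) := by
  subst hy
  exact mfderiv_comp x hk hf

theorem mfderiv_clm_apply {V : Type*} [NormedAddCommGroup V] [NormedSpace ℝ V]
    {A : M₁ → (V →L[ℝ] V)} {s : M₁ → V} {x : M₁}
    (hA : MDifferentiableAt 𝓘(ℝ, E₁) 𝓘(ℝ, V →L[ℝ] V) A x)
    (hs : MDifferentiableAt 𝓘(ℝ, E₁) 𝓘(ℝ, V) s x) (Y : E₁) :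
    modelDeriv E₁ V (fun h => A h (s h)) x Y =
      modelDeriv E₁ (V →L[ℝ] V) A x Y (s x) + A x (modelDeriv E₁ V s x Y) := by
  have hF := hA.prodMk_space hs
  have h2 := (isBoundedBilinearMap_apply (𝕜 := ℝ) (E := V) (F := V)).hasFDerivAt (A x, s x)
  have e := mfderiv_chain h2.differentiableAt.mdifferentiableAt hF rfl
  have e1 := mfderiv_chain (k := ContinuousLinearMap.fst ℝ (V →L[ℝ] V) V) (y := (A x, s x))
    (ContinuousLinearMap.fst ℝ (V →L[ℝ] V) V).differentiableAt.mdifferentiableAt hF rfl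
  have e2 := mfderiv_chain (k := ContinuousLinearMap.snd ℝ (V →L[ℝ] V) V) (y := (A x, s x))
    (ContinuousLinearMap.snd ℝ (V →L[ℝ] V) V).differentiableAt.mdifferentiableAt hF rfl
  simp only [modelDeriv] at e e1 e2
  rw [mfderiv_eq_fderiv, h2.fderiv] at e
  rw [mfderiv_eq_fderiv, ContinuousLinearMap.fderiv] at e1 e2
  have a := DFunLike.congr_fun e Y
  have a1 := DFunLike.congr_fun e1 Y
  have a2 := DFunLike.congr_fun e2 Y
  refine a.trans ?_
  rw [add_comm]
  exact congrArg₂ (fun p q => A x q + p (s x)) a1.symm a2.symm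

theorem modelDeriv_clm (k : E₁ →L[ℝ] E₂) (x : E₁) : modelDeriv E₁ E₂ k x = k := by
  simp only [modelDeriv]
  rw [mfderiv_eq_fderiv]
  exact k.fderiv

theorem modelDeriv_const (c : M₂) (x : M₁) : modelDeriv E₁ E₂ (fun _ => c) x = 0 :=
  mfderiv_const

end ChainRule

section Adjoint

variable (E : Type*) [NormedAddCommGroup E] [NormedSpace ℝ E]
  {G : Type*} [TopologicalSpace G] [ChartedSpace E G] [Group G]

/-- The adjoint action of `g`: the derivative at `1` of `x ↦ g x g⁻¹`. -/
def Ad (g : G) : LieAlg E G →L[ℝ] LieAlg E G :=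
  mfderiv 𝓘(ℝ, E) 𝓘(ℝ, E) (fun x : G => g * x * g⁻¹) 1

variable [LieGroup 𝓘(ℝ, E) ∞ G]

theorem contMDiff_conj (g : G) :
    ContMDiff 𝓘(ℝ, E) 𝓘(ℝ, E) ∞ (fun x : G => g * x * g⁻¹) :=
  (contMDiff_mul_right (a := g⁻¹)).comp (contMDiff_mul_left (a := g))

theorem Ad_one : Ad E (1 : G) = ContinuousLinearMap.id ℝ _ := by
  have : (fun x : G => 1 * x * 1⁻¹) = id := by ext x; simp
  unfold Ad
  rw [this]
  exact mfderiv_id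

theorem Ad_mul (g h : G) : Ad E (g * h) = (Ad E g).comp (Ad E h) := by
  have h1 : (fun x : G => (g * h) * x * (g * h)⁻¹) =
      (fun x : G => g * x * g⁻¹) ∘ (fun x : G => h * x * h⁻¹) := by
    ext x; simp [mul_assoc]
  unfold Ad
  rw [h1]
  exact mfderiv_chain (E₁ := E) (E₂ := E) (E₃ := E) (x := (1 : G)) (y := (1 : G))
    ((contMDiff_conj E g).mdifferentiable (by simp) _)
    ((contMDiff_conj E h).mdifferentiable (by simp) _) (by simp)

theorem Ad_inv_Ad (g : G) (X : LieAlg E G) : Ad E g⁻¹ (Ad E g X) = X := by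
  have := Ad_mul E g⁻¹ g
  rw [inv_mul_cancel, Ad_one] at this
  exact (DFunLike.congr_fun this X).symm

theorem Ad_Ad_inv (g : G) (X : LieAlg E G) : Ad E g (Ad E g⁻¹ X) = X := by
  simpa using Ad_inv_Ad E g⁻¹ X

variable [FiniteDimensional ℝ E]

theorem mpullback_conj (g : G) (X : LieAlg E G) :
    VectorField.mpullback 𝓘(ℝ, E) 𝓘(ℝ, E) (fun x : G => g⁻¹ * x * g⁻¹⁻¹)
      (mulInvariantVectorField X.tan) =
    mulInvariantVectorField (Ad E g X).tan := by
  ext x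
  have hc := fun g : G => (contMDiff_conj E g).mdifferentiable (by simp)
  have hl := fun g : G => (contMDiff_mul_left (I := 𝓘(ℝ, E)) (n := ∞) (a := g)).mdifferentiable
    (by simp)
  have A : (mfderiv 𝓘(ℝ, E) 𝓘(ℝ, E) (fun x : G => g⁻¹ * x * g⁻¹⁻¹) x).inverse =
      mfderiv 𝓘(ℝ, E) 𝓘(ℝ, E) (fun x : G => g * x * g⁻¹) (g⁻¹ * x * g⁻¹⁻¹) := by
    apply ContinuousLinearMap.inverse_eq
    · have : (fun x : G => g⁻¹ * x * g⁻¹⁻¹) ∘ (fun x : G => g * x * g⁻¹) = id := by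
        ext x; simp [mul_assoc]
      have e := mfderiv_chain (x := g⁻¹ * x * g⁻¹⁻¹) (y := x) (hc g⁻¹ x) (hc g _)
        (by simp [mul_assoc])
      rw [this] at e
      exact e.symm.trans mfderiv_id
    · have : (fun x : G => g * x * g⁻¹) ∘ (fun x : G => g⁻¹ * x * g⁻¹⁻¹) = id := by
        ext x; simp [mul_assoc]
      have e := mfderiv_chain (x := x) (y := g⁻¹ * x * g⁻¹⁻¹) (hc g _) (hc g⁻¹ x) rfl
      rw [this] at e
      exact e.symm.trans mfderiv_id
  simp only [VectorField.mpullback, mulInvariantVectorField, A]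
  have e1 := mfderiv_chain (x := (1 : G)) (y := g⁻¹ * x * g⁻¹⁻¹) (hc g _)
    (hl (g⁻¹ * x * g⁻¹⁻¹) 1) (by simp)
  have e2 := mfderiv_chain (x := (1 : G)) (y := (1 : G)) (hl x 1) (hc g 1) (by simp)
  have e3 : (fun y : G => g * y * g⁻¹) ∘ (fun y : G => g⁻¹ * x * g⁻¹⁻¹ * y) =
      (fun y : G => x * y) ∘ (fun y : G => g * y * g⁻¹) := by
    ext y; simp [mul_assoc]
  rw [e3, e2] at e1
  exact (DFunLike.congr_fun e1 X).symm

theorem Ad_lie (g : G) (X Y : LieAlg E G) : Ad E g ⁅X, Y⁆ = ⁅Ad E g X, Ad E g Y⁆ := by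
  have := lieGroup_three E G
  have : CompleteSpace E := FiniteDimensional.complete ℝ E
  have h := VectorField.mpullback_mlieBracket (n := ∞) (I := 𝓘(ℝ, E)) (I' := 𝓘(ℝ, E))
    (f := fun x : G => g⁻¹ * x * g⁻¹⁻¹) (x₀ := 1)
    (V := mulInvariantVectorField X.tan)
    (W := mulInvariantVectorField Y.tan)
    (mdifferentiableAt_mulInvariantVectorField _) (mdifferentiableAt_mulInvariantVectorField _)
    (contMDiff_conj E g⁻¹).contMDiffAt (by
      rw [minSmoothness_of_isRCLikeNormedField]; exact WithTop.coe_le_coe.2 le_top)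
  rw [mpullback_conj, mpullback_conj, ← mulInvariantVector_mlieBracket] at h
  have h' := congrFun (mpullback_conj E g ⁅X, Y⁆) 1
  replace h := h'.symm.trans h
  have one : ∀ Z : GroupLieAlgebra 𝓘(ℝ, E) G, mulInvariantVectorField Z (1 : G) = Z := by
    intro Z
    have : (fun y : G => 1 * y) = id := by ext; simp
    simp only [mulInvariantVectorField]
    rw [this, mfderiv_id]
    rfl
  rw [one] at h
  exact h

/-- `Ad g` as an automorphism of the Lie algebra. -/
def AdEquiv (g : G) : LieAlg E G ≃ₗ⁅ℝ⁆ LieAlg E G where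
  toFun := Ad E g
  map_add' := map_add _
  map_smul' := map_smul _
  map_lie' := Ad_lie E g _ _
  invFun := Ad E g⁻¹
  left_inv := Ad_inv_Ad E g
  right_inv := Ad_Ad_inv E g

theorem killingForm_Ad (g : G) (X Y : LieAlg E G) :
    killingForm ℝ (LieAlg E G) (Ad E g X) (Ad E g Y) = killingForm ℝ (LieAlg E G) X Y :=
  LieAlgebra.killingForm_of_equiv_apply (AdEquiv E g) X Y

end Adjoint

section SmoothForms

variable {EB : Type*} [NormedAddCommGroup EB] [NormedSpace ℝ EB] [FiniteDimensional ℝ EB]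
  {B : Type*} [TopologicalSpace B] [ChartedSpace EB B]
  {W : Type*} [NormedAddCommGroup W] [NormedSpace ℝ W]
  {L : Type*} [NormedAddCommGroup L] [NormedSpace ℝ L]

theorem contMDiffAt_clm_of_apply {f : B → (L →L[ℝ] W)} [FiniteDimensional ℝ L] {u : B}
    (h : ∀ v, ContMDiffAt 𝓘(ℝ, EB) 𝓘(ℝ, W) ∞ (fun x => f x v) u) :
    ContMDiffAt 𝓘(ℝ, EB) 𝓘(ℝ, L →L[ℝ] W) ∞ f u := by
  classical
  let b := Module.finBasis ℝ L
  have e : f = fun x => ∑ i, ContinuousLinearMap.smulRightL ℝ L W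
      (LinearMap.toContinuousLinearMap (b.coord i)) (f x (b i)) := by
    ext x v
    have := congrArg (f x) (b.sum_repr v)
    rw [← this]
    simp only [map_sum, map_smul]
    simp
  rw [e]
  refine ContMDiffAt.sum fun i _ => ?_
  exact (ContinuousLinearMap.contMDiff _).contMDiffAt.comp u (h (b i))

variable [IsManifold 𝓘(ℝ, EB) ∞ B]

theorem contMDiffAt_comp_symmL {F : ∀ u : B, TangentSpace 𝓘(ℝ, EB) u →L[ℝ] W}
    (hF : ContMDiff 𝓘(ℝ, EB).tangent 𝓘(ℝ, W) ∞
      (fun v : TangentBundle 𝓘(ℝ, EB) B => F v.1 v.2)) (u₀ : B) :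
    ContMDiffAt 𝓘(ℝ, EB) 𝓘(ℝ, EB →L[ℝ] W) ∞
      (fun u => (F u).comp
        ((trivializationAt EB (TangentSpace 𝓘(ℝ, EB)) u₀).symmL ℝ u)) u₀ := by
  apply contMDiffAt_clm_of_apply
  intro v
  let e := trivializationAt EB (TangentSpace 𝓘(ℝ, EB) : B → Type _) u₀
  have hmem : (u₀, v) ∈ e.target := by
    rw [e.mem_target]; exact FiberBundle.mem_baseSet_trivializationAt' u₀
  have h1 : ContMDiffAt (𝓘(ℝ, EB).prod 𝓘(ℝ, EB)) 𝓘(ℝ, EB).tangent ∞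
      e.toOpenPartialHomeomorph.symm (u₀, v) :=
    (e.contMDiffOn_symm (IB := 𝓘(ℝ, EB)) (n := ∞)).contMDiffAt (e.open_target.mem_nhds hmem)
  have h2 : ContMDiffAt 𝓘(ℝ, EB) (𝓘(ℝ, EB).prod 𝓘(ℝ, EB)) ∞ (fun u : B => (u, v)) u₀ :=
    contMDiffAt_id.prodMk contMDiffAt_const
  have h3 := (hF.contMDiffAt.comp (u₀, v) h1).comp u₀ h2
  refine h3.congr_of_eventuallyEq ?_
  filter_upwards [e.open_baseSet.mem_nhds (FiberBundle.mem_baseSet_trivializationAt' u₀)]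
    with u hu
  have := e.mk_symm hu v
  simp only [Function.comp_def, ContinuousLinearMap.comp_apply]
  change F u (e.symmL ℝ u v) = F (e.toOpenPartialHomeomorph.symm (u, v)).1 _
  rw [← this, Bundle.Trivialization.symmL_apply _ hu]

theorem contMDiff_comp_equiv_symm {F : ∀ u : B, TangentSpace 𝓘(ℝ, EB) u →L[ℝ] W}
    (hF : ContMDiff 𝓘(ℝ, EB).tangent 𝓘(ℝ, W) ∞
      (fun v : TangentBundle 𝓘(ℝ, EB) B => F v.1 v.2))
    {η : ∀ u : B, TangentSpace 𝓘(ℝ, EB) u ≃L[ℝ] L}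
    (hη : ContMDiff 𝓘(ℝ, EB).tangent 𝓘(ℝ, L) ∞
      (fun v : TangentBundle 𝓘(ℝ, EB) B => η v.1 v.2)) :
    ContMDiff 𝓘(ℝ, EB) 𝓘(ℝ, L →L[ℝ] W) ∞
      (fun u => (F u).comp (η u).symm.toContinuousLinearMap) := by
  intro u₀
  let e := trivializationAt EB (TangentSpace 𝓘(ℝ, EB) : B → Type _) u₀
  have hF' := contMDiffAt_comp_symmL hF u₀
  have hη' := contMDiffAt_comp_symmL (F := fun u => (η u).toContinuousLinearMap) hη u₀
  have key : ∀ u (hu : u ∈ e.baseSet), (η u).toContinuousLinearMap.comp (e.symmL ℝ u) =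
      ((e.continuousLinearEquivAt ℝ u hu).symm.trans (η u)).toContinuousLinearMap := by
    intro u hu
    ext v
    simp [e.symmL_apply hu]
  have hu₀ : u₀ ∈ e.baseSet := FiberBundle.mem_baseSet_trivializationAt' u₀
  have : CompleteSpace EB := FiniteDimensional.complete ℝ EB
  have hinv : ContMDiffAt 𝓘(ℝ, EB) 𝓘(ℝ, L →L[ℝ] EB) ∞ (fun u => ContinuousLinearMap.inverse
      ((η u).toContinuousLinearMap.comp (e.symmL ℝ u))) u₀ := by
    have h1 : ContDiffAt ℝ ∞ (ContinuousLinearMap.inverse : (EB →L[ℝ] L) → _)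
      ((η u₀).toContinuousLinearMap.comp (e.symmL ℝ u₀)) := by
      rw [key u₀ hu₀]; exact contDiffAt_map_inverse _
    exact h1.contMDiffAt.comp u₀ hη'
  refine (hF'.clm_comp hinv).congr_of_eventuallyEq ?_
  filter_upwards [e.open_baseSet.mem_nhds hu₀] with u hu
  rw [key u hu, ContinuousLinearMap.inverse_equiv]
  ext X
  have h : e.symmL ℝ u (e ⟨u, (η u).symm X⟩).2 = (η u).symm X := by
    rw [e.symmL_apply hu]
    exact (e.continuousLinearEquivAt ℝ u hu).symm_apply_apply _
  exact congrArg (F u) h.symm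

end SmoothForms

section LieTheory

variable {L : Type*} [LieRing L] [LieAlgebra ℝ L]

/-- A subalgebra `𝔭` (given by its underlying subspace) of a real Lie algebra `L` is parabolic if its
complexification is a standard parabolic for a suitable choice of a Cartan subalgebra `H` of the
complexification of `L` and of positive roots, i.e. contains `H` and all positive root spaces.
Here a root is a nonzero functional with a nonzero root space, and a positive system is a set of
roots which contains exactly one of `α`, `-α` for each root `α`, and contains each root that is a
sum of two of its elements. -/
def IsParabolicSubalgebra (p : Submodule ℝ L) : Prop :=
  ∃ (H : LieSubalgebra ℂ (ℂ ⊗[ℝ] L)) (_ : H.IsCartanSubalgebra) (Pos : Set (H → ℂ)),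
    (∀ α ∈ Pos, α ≠ 0 ∧ LieAlgebra.rootSpace H α ≠ ⊥) ∧
    (∀ α : H → ℂ, α ≠ 0 → LieAlgebra.rootSpace H α ≠ ⊥ → Xor (α ∈ Pos) (-α ∈ Pos)) ∧
    (∀ α ∈ Pos, ∀ β ∈ Pos, LieAlgebra.rootSpace H (α + β) ≠ ⊥ → α + β ∈ Pos) ∧
    H.toSubmodule ≤ p.baseChange ℂ ∧
    ∀ α ∈ Pos, (LieAlgebra.rootSpace H α).toSubmodule ≤ p.baseChange ℂ

variable [FiniteDimensional ℝ L]

/-- `𝔭₊`, the orthocomplement of `𝔭` for the Killing form. For a parabolic subalgebra `𝔭` of a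
semisimple Lie algebra it is the nilradical of `𝔭`, i.e. the positive part of the grading. -/
def pPlus (p : Submodule ℝ L) : Submodule ℝ L :=
  LinearMap.BilinForm.orthogonal (killingForm ℝ L) p

variable [LieAlgebra.IsSemisimple ℝ L]

/-- The Killing form as an isomorphism `𝔤 ≅ 𝔤*`. -/
def killingEquiv : L ≃ₗ[ℝ] Module.Dual ℝ L :=
  LinearMap.BilinForm.toDual (killingForm ℝ L) (LieAlgebra.IsKilling.killingForm_nondegenerate ℝ L)

theorem mem_pPlus_iff (p : Submodule ℝ L) (Z : L) :
    Z ∈ pPlus p ↔ ∀ X ∈ p, killingForm ℝ L Z X = 0 := by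
  simp only [pPlus, LinearMap.BilinForm.mem_orthogonal_iff]
  exact forall₂_congr fun X _ => by rw [LieModule.traceForm_comm]

/-- The isomorphism `𝔭₊ ≅ (𝔤/𝔭)*` induced by the Killing form, `Z ↦ (X + 𝔭 ↦ B(Z, X))`. -/
def pPlusEquiv (p : Submodule ℝ L) : pPlus p ≃ₗ[ℝ] Module.Dual ℝ (L ⧸ p) :=
  LinearEquiv.ofBijective
    { toFun := fun Z : pPlus p =>
        p.liftQ (killingForm ℝ L (Z : L)) fun X hX => (mem_pPlus_iff p Z).1 Z.2 X hX
      map_add' := fun Z Z' => by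
        ext X
        exact LinearMap.congr_fun (map_add (killingForm ℝ L) (Z : L) Z') X
      map_smul' := fun c Z => by
        ext X
        exact LinearMap.congr_fun (map_smul (killingForm ℝ L) c (Z : L)) X }
    ⟨by
      intro Z Z' h
      apply Subtype.ext
      apply (killingEquiv (L := L)).injective
      ext X
      exact DFunLike.congr_fun h (p.mkQ X), by
      intro f
      refine ⟨⟨killingEquiv.symm (f.comp p.mkQ), (mem_pPlus_iff p _).2 fun X hX => ?_⟩, ?_⟩
      · have := DFunLike.congr_fun (killingEquiv.apply_symm_apply (f.comp p.mkQ)) X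
        refine this.trans ?_
        simp [(Submodule.Quotient.mk_eq_zero p).2 hX]
      · ext X
        exact DFunLike.congr_fun (killingEquiv.apply_symm_apply (f.comp p.mkQ)) X⟩

/-- The induced isomorphism `𝔭₊ ⊗ V ≅ Hom(𝔤/𝔭, V)`, `Z ⊗ v ↦ (X + 𝔭 ↦ B(Z, X) v)`. -/
def pPlusTensorEquiv (p : Submodule ℝ L) (V : Type*) [AddCommGroup V] [Module ℝ V] :
    pPlus p ⊗[ℝ] V ≃ₗ[ℝ] (L ⧸ p →ₗ[ℝ] V) :=
  (TensorProduct.congr (pPlusEquiv p) (LinearEquiv.refl ℝ V)).trans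
    (dualTensorHomEquiv ℝ (L ⧸ p) V)

/-- A fixed basis `ξ^ℓ` of `𝔤`. -/
def lieBasis (L : Type*) [LieRing L] [LieAlgebra ℝ L] [FiniteDimensional ℝ L] :
    Module.Basis (Fin (Module.finrank ℝ L)) ℝ L :=
  Module.finBasis ℝ L

/-- The basis `ξ_ℓ` dual to `lieBasis` with respect to the Killing form. -/
def lieDualBasis (L : Type*) [LieRing L] [LieAlgebra ℝ L] [FiniteDimensional ℝ L]
    [LieAlgebra.IsSemisimple ℝ L] : Module.Basis (Fin (Module.finrank ℝ L)) ℝ L :=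
  LinearMap.BilinForm.dualBasis (killingForm ℝ L)
    (LieAlgebra.IsKilling.killingForm_nondegenerate ℝ L) (lieBasis L)

theorem killingForm_lieBasis (i j : Fin (Module.finrank ℝ L)) :
    killingForm ℝ L (lieBasis L i) (lieDualBasis L j) = if i = j then 1 else 0 := by
  rw [LieModule.traceForm_comm]
  exact LinearMap.BilinForm.apply_dualBasis_left (B := killingForm ℝ L)
    (LieAlgebra.IsKilling.killingForm_nondegenerate ℝ L) (lieBasis L) j i

/-- The contraction `B ⊗ id : 𝔤* ⊗ 𝔤* ⊗ W → W` of a bilinear map with the Killing form, computed in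
a pair of dual bases. -/
def killingContract {W : Type*} [AddCommGroup W] [Module ℝ W] (T : L →ₗ[ℝ] L →ₗ[ℝ] W) : W :=
  ∑ i, T (lieBasis L i) (lieDualBasis L i)

/-- The contraction may be computed in any pair of dual bases. -/
theorem killingContract_eq {W : Type*} [AddCommGroup W] [Module ℝ W] (T : L →ₗ[ℝ] L →ₗ[ℝ] W)
    {ι : Type*} [Fintype ι] [DecidableEq ι] (c c' : Module.Basis ι ℝ L)
    (h : ∀ i j, killingForm ℝ L (c i) (c' j) = if i = j then 1 else 0) :
    killingContract T = ∑ i, T (c i) (c' i) := by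
  have hb : ∀ i j, killingForm ℝ L (lieDualBasis L i) (lieBasis L j) = if j = i then 1 else 0 :=
    fun i j => by rw [LieModule.traceForm_comm, killingForm_lieBasis]
  have e1 : ∀ X : L, X = ∑ j, killingForm ℝ L X (c' j) • c j := by
    intro X
    conv_lhs => rw [← c.sum_repr X]
    refine Finset.sum_congr rfl fun j _ => ?_
    congr 1
    have := congrArg (fun Z => killingForm ℝ L Z (c' j)) (c.sum_repr X)
    simpa [h, -Module.Basis.sum_repr] using this
  have e2 : ∀ X : L, X = ∑ i, killingForm ℝ L (lieBasis L i) X • lieDualBasis L i := by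
    intro X
    conv_lhs => rw [← (lieDualBasis L).sum_repr X]
    refine Finset.sum_congr rfl fun j _ => ?_
    congr 1
    have := congrArg (fun Z => killingForm ℝ L Z (lieBasis L j)) ((lieDualBasis L).sum_repr X)
    rw [LieModule.traceForm_comm ℝ L L (lieBasis L j) X]
    simpa [hb, -Module.Basis.sum_repr] using this
  have s1 : killingContract T =
      ∑ i, ∑ j, killingForm ℝ L (lieBasis L i) (c' j) • T (c j) (lieDualBasis L i) := by
    refine Finset.sum_congr rfl fun i _ => ?_
    conv_lhs => rw [e1 (lieBasis L i)]
    simp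
  rw [s1, Finset.sum_comm]
  refine Finset.sum_congr rfl fun j _ => ?_
  conv_rhs => rw [e2 (c' j)]
  simp

end LieTheory

/-- A smooth principal bundle `proj : B → M` with structure group `P`, acting from the right. -/
structure PrincipalBundle (EP : Type*) [NormedAddCommGroup EP] [NormedSpace ℝ EP]
    (P : Type*) [TopologicalSpace P] [ChartedSpace EP P] [Group P]
    (EB : Type*) [NormedAddCommGroup EB] [NormedSpace ℝ EB]
    (B : Type*) [TopologicalSpace B] [ChartedSpace EB B]
    (EM : Type*) [NormedAddCommGroup EM] [NormedSpace ℝ EM]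
    (M : Type*) [TopologicalSpace M] [ChartedSpace EM M] where
  proj : B → M
  act : B → P → B
  act_one : ∀ u, act u 1 = u
  act_mul : ∀ u g h, act u (g * h) = act (act u g) h
  smooth_act : ContMDiff (𝓘(ℝ, EB).prod 𝓘(ℝ, EP)) 𝓘(ℝ, EB) ∞ fun x : B × P => act x.1 x.2
  smooth_proj : ContMDiff 𝓘(ℝ, EB) 𝓘(ℝ, EM) ∞ proj
  proj_act : ∀ u h, proj (act u h) = proj u
  /-- Local triviality: near each point of `M` there is a `P`-equivariant diffeomorphism
  `φ` from `proj⁻¹(U)` onto `U × P` over `U`. -/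
  locally_trivial : ∀ x : M, ∃ U : Set M, IsOpen U ∧ x ∈ U ∧
    ∃ φ : OpenPartialHomeomorph B (M × P),
      φ.source = proj ⁻¹' U ∧ φ.target = U ×ˢ Set.univ ∧
      ContMDiffOn 𝓘(ℝ, EB) (𝓘(ℝ, EM).prod 𝓘(ℝ, EP)) ∞ φ φ.source ∧
      ContMDiffOn (𝓘(ℝ, EM).prod 𝓘(ℝ, EP)) 𝓘(ℝ, EB) ∞ φ.symm φ.target ∧
      ∀ u ∈ φ.source, (φ u).1 = proj u ∧ ∀ h, (φ (act u h)).2 = (φ u).2 * h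

section Geometry

variable {EG : Type*} [NormedAddCommGroup EG] [NormedSpace ℝ EG] [FiniteDimensional ℝ EG]
  {G : Type*} [TopologicalSpace G] [ChartedSpace EG G] [Group G] [LieGroup 𝓘(ℝ, EG) ∞ G]

/-- The derivative at `1` of the inclusion `P → G`, i.e. the inclusion of Lie algebras. -/
def lieIncl (EG : Type*) [NormedAddCommGroup EG] [NormedSpace ℝ EG] {G : Type*}
    [TopologicalSpace G] [ChartedSpace EG G] [Group G] (P : Subgroup G) (EP : Type*)
    [NormedAddCommGroup EP] [NormedSpace ℝ EP] [ChartedSpace EP P] : EP →L[ℝ] LieAlg EG G :=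
  mfderiv 𝓘(ℝ, EP) 𝓘(ℝ, EG) (Subtype.val : P → G) 1

/-- The Lie algebra `𝔭 ⊆ 𝔤` of the subgroup `P ⊆ G`. -/
def lieSub (EG : Type*) [NormedAddCommGroup EG] [NormedSpace ℝ EG] {G : Type*}
    [TopologicalSpace G] [ChartedSpace EG G] [Group G] (P : Subgroup G) (EP : Type*)
    [NormedAddCommGroup EP] [NormedSpace ℝ EP] [ChartedSpace EP P] : Submodule ℝ (LieAlg EG G) :=
  LinearMap.range (lieIncl EG P EP : EP →ₗ[ℝ] LieAlg EG G)

/-- `P` is a parabolic subgroup of `G`: a closed (embedded) Lie subgroup whose Lie algebra is a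
parabolic subalgebra of the Lie algebra of `G`. -/
structure IsParabolicSubgroup (EG : Type*) [NormedAddCommGroup EG] [NormedSpace ℝ EG]
    [FiniteDimensional ℝ EG] {G : Type*} [TopologicalSpace G] [ChartedSpace EG G] [Group G]
    [LieGroup 𝓘(ℝ, EG) ∞ G] (P : Subgroup G) (EP : Type*)
    [NormedAddCommGroup EP] [NormedSpace ℝ EP] [ChartedSpace EP P] : Prop where
  isClosed : IsClosed (P : Set G)
  isSmoothEmbedding :
    Manifold.IsSmoothEmbedding 𝓘(ℝ, EP) 𝓘(ℝ, EG) ∞ (Subtype.val : P → G)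
  isParabolic : IsParabolicSubalgebra (lieSub EG P EP)

/-- A Cartan geometry of type `(G, P)` on `M`: a principal `P`-bundle `B → M` with a Cartan
connection, i.e. a smooth `𝔤`-valued one-form `conn` on `B` which is an isomorphism on each tangent
space, is `P`-equivariant, and reproduces the generators of fundamental vector fields. It is a
parabolic geometry if `G` is semisimple and `P` is parabolic. -/
structure CartanGeometry (EG : Type*) [NormedAddCommGroup EG] [NormedSpace ℝ EG]
    {G : Type*} [TopologicalSpace G] [ChartedSpace EG G] [Group G]
    (EP : Type*) [NormedAddCommGroup EP] [NormedSpace ℝ EP] (P : Subgroup G) [ChartedSpace EP P]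
    (EB : Type*) [NormedAddCommGroup EB] [NormedSpace ℝ EB]
    (B : Type*) [TopologicalSpace B] [ChartedSpace EB B] [IsManifold 𝓘(ℝ, EB) ∞ B]
    (EM : Type*) [NormedAddCommGroup EM] [NormedSpace ℝ EM]
    (M : Type*) [TopologicalSpace M] [ChartedSpace EM M]
    extends PrincipalBundle EP P EB B EM M where
  conn : ∀ u : B, TangentSpace 𝓘(ℝ, EB) u ≃L[ℝ] LieAlg EG G
  smooth_conn : ContMDiff 𝓘(ℝ, EB).tangent 𝓘(ℝ, LieAlg EG G) ∞
    fun v : TangentBundle 𝓘(ℝ, EB) B => conn v.1 v.2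
  conn_act : ∀ (u : B) (h : P) (v : TangentSpace 𝓘(ℝ, EB) u),
    conn (act u h) (mfderiv 𝓘(ℝ, EB) 𝓘(ℝ, EB) (fun w => act w h) u v) =
      Ad EG (h⁻¹ : G) (conn u v)
  conn_fundamental : ∀ (u : B) (Y : EP),
    conn (act u 1) (mfderiv 𝓘(ℝ, EP) 𝓘(ℝ, EB) (act u) 1 Y) = lieIncl EG P EP Y

variable {P : Subgroup G} {EP : Type*} [NormedAddCommGroup EP] [NormedSpace ℝ EP]
  [FiniteDimensional ℝ EP] [ChartedSpace EP P] [LieGroup 𝓘(ℝ, EP) ∞ P]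
  {EB : Type*} [NormedAddCommGroup EB] [NormedSpace ℝ EB] [FiniteDimensional ℝ EB]
  {B : Type*} [TopologicalSpace B] [ChartedSpace EB B] [IsManifold 𝓘(ℝ, EB) ∞ B]
  {EM : Type*} [NormedAddCommGroup EM] [NormedSpace ℝ EM] [FiniteDimensional ℝ EM]
  {M : Type*} [TopologicalSpace M] [ChartedSpace EM M] [IsManifold 𝓘(ℝ, EM) ∞ M]
  {W : Type*} [NormedAddCommGroup W] [NormedSpace ℝ W]

/-- The space `Γ(WM)` of smooth sections of the natural bundle `WM = B ×_P W` induced by a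
representation `W` of `P`, described as the space `C^∞(B, W)^P` of equivariant functions. -/
structure NatSection (geo : CartanGeometry EG EP P EB B EM M) (ρ : P →* (W →L[ℝ] W)) where
  toFun : B → W
  smooth : ContMDiff 𝓘(ℝ, EB) 𝓘(ℝ, W) ∞ toFun
  equivariant : ∀ u h, toFun (geo.act u h) = ρ h⁻¹ (toFun u)

/-- The representation of `P` on `𝔤* ⊗ W = Hom(𝔤, W)`, `(h · φ)(X) = h · φ(Ad(h⁻¹) X)`. -/
def homRep (ρ : P →* (W →L[ℝ] W)) :
    P →* ((LieAlg EG G →L[ℝ] W) →L[ℝ] (LieAlg EG G →L[ℝ] W)) where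
  toFun h := (ContinuousLinearMap.compL ℝ (LieAlg EG G) W W (ρ h)).comp
    ((ContinuousLinearMap.compL ℝ (LieAlg EG G) (LieAlg EG G) W).flip (Ad EG (h⁻¹ : G)))
  map_one' := by
    ext φ X
    simp [Ad_one]
  map_mul' g h := by
    ext φ X
    simp [Ad_mul]

theorem homRep_apply (ρ : P →* (W →L[ℝ] W)) (h : P) (φ : LieAlg EG G →L[ℝ] W) (X : LieAlg EG G) :
    homRep ρ h φ X = ρ h (φ (Ad EG (h⁻¹ : G) X)) := rfl

variable {geo : CartanGeometry EG EP P EB B EM M} {ρ : P →* (W →L[ℝ] W)}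

theorem smooth_act_right (geo : CartanGeometry EG EP P EB B EM M) (h : P) :
    ContMDiff 𝓘(ℝ, EB) 𝓘(ℝ, EB) ∞ (fun w => geo.act w h) :=
  geo.smooth_act.comp (contMDiff_id.prodMk contMDiff_const)

theorem conn_symm_act (geo : CartanGeometry EG EP P EB B EM M) (u : B) (h : P)
    (X : LieAlg EG G) : (geo.conn (geo.act u h)).symm X =
      mfderiv 𝓘(ℝ, EB) 𝓘(ℝ, EB) (fun w => geo.act w h) u
        ((geo.conn u).symm (Ad EG (h : G) X)) := by
  rw [ContinuousLinearEquiv.symm_apply_eq, geo.conn_act, ContinuousLinearEquiv.apply_symm_apply,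
    Ad_inv_Ad]

/-- The derivative of a function `f` on `B` along the vector fields which the Cartan connection maps
to constants, `X ↦ df(u)(conn_u⁻¹(X))`. -/
def constDeriv (geo : CartanGeometry EG EP P EB B EM M) (f : B → W) (u : B) :
    LieAlg EG G →L[ℝ] W :=
  (mfderiv 𝓘(ℝ, EB) 𝓘(ℝ, W) f u).comp (geo.conn u).symm.toContinuousLinearMap

theorem constDeriv_apply (f : B → W) (u : B) (X : LieAlg EG G) :
    constDeriv geo f u X = mfderiv 𝓘(ℝ, EB) 𝓘(ℝ, W) f u ((geo.conn u).symm X) := rfl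

/-- The fundamental derivative `D : Γ(WM) → Γ(𝒜*M ⊗ WM)`, `Dσ(u)(X) = dσ(u)(conn_u⁻¹(X))`. -/
def fundDeriv (σ : NatSection geo ρ) : NatSection geo (homRep (EG := EG) ρ) where
  toFun := constDeriv geo σ.toFun
  smooth := by
    refine contMDiff_comp_equiv_symm (η := geo.conn)
      (F := fun u => (mfderiv 𝓘(ℝ, EB) 𝓘(ℝ, W) σ.toFun u : TangentSpace 𝓘(ℝ, EB) u →L[ℝ] W))
      ?_ geo.smooth_conn
    have h1 := σ.smooth.contMDiff_tangentMap (m := ∞) (by simp)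
    exact (contMDiff_snd_tangentBundle_modelSpace W 𝓘(ℝ, W)).comp h1
  equivariant u h := by
    have hs := fun x => σ.smooth.mdifferentiable (by simp) x
    have e : σ.toFun ∘ (fun w => geo.act w h) = (ρ h⁻¹) ∘ σ.toFun := by
      ext w; exact σ.equivariant w h
    have e1 := mfderiv_chain (x := u) (hs (geo.act u h))
      ((smooth_act_right geo h).mdifferentiable (by simp) u) rfl
    have e2 := mfderiv_chain (x := u) (y := σ.toFun u)
      ((ρ h⁻¹).differentiableAt.mdifferentiableAt) (hs u) rfl
    rw [e, e2, modelDeriv_clm] at e1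
    ext X
    have e3 := DFunLike.congr_fun e1 ((geo.conn u).symm (Ad EG (h : G) X))
    rw [homRep_apply, constDeriv_apply, constDeriv_apply, conn_symm_act]
    simp only [Subgroup.coe_inv, inv_inv]
    exact e3.symm

variable [LieAlgebra.IsSemisimple ℝ (LieAlg EG G)]

/-- A continuous bilinear map as a bilinear map. -/
def toBilin (T : LieAlg EG G →L[ℝ] LieAlg EG G →L[ℝ] W) :
    LieAlg EG G →ₗ[ℝ] LieAlg EG G →ₗ[ℝ] W :=
  T.toLinearMap₁₂

/-- The curved Casimir operator `𝒞 = (B ⊗ id) ∘ D² : Γ(WM) → Γ(WM)`, where `B` is the Killing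
form. -/
def curvedCasimir (σ : NatSection geo ρ) : NatSection geo ρ where
  toFun u := killingContract (toBilin ((fundDeriv (fundDeriv σ)).toFun u))
  smooth := by
    unfold killingContract
    refine contMDiff_finsetSum fun i _ => ?_
    exact ((fundDeriv (fundDeriv σ)).smooth.clm_apply contMDiff_const).clm_apply contMDiff_const
  equivariant u h := by
    classical
    rw [(fundDeriv (fundDeriv σ)).equivariant]
    rw [killingContract_eq _ ((lieBasis (LieAlg EG G)).map (AdEquiv EG (h⁻¹ : G)).toLinearEquiv)
      ((lieDualBasis (LieAlg EG G)).map (AdEquiv EG (h⁻¹ : G)).toLinearEquiv)]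
    · simp only [killingContract, map_sum]
      refine Finset.sum_congr rfl fun i _ => ?_
      have key : ∀ (T : LieAlg EG G →L[ℝ] LieAlg EG G →L[ℝ] W) (X Y : LieAlg EG G),
          homRep (homRep ρ) h⁻¹ T (Ad EG (h⁻¹ : G) X) (Ad EG (h⁻¹ : G) Y) = ρ h⁻¹ (T X Y) := by
        intro T X Y
        rw [homRep_apply, homRep_apply]
        simp only [Subgroup.coe_inv, Ad_inv_Ad]
      exact key _ _ _
    · intro i j
      exact (killingForm_Ad EG (h⁻¹ : G) _ _).trans (killingForm_lieBasis i j)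

end Geometry

section Representations

variable {EG : Type*} [NormedAddCommGroup EG] [NormedSpace ℝ EG]
  {G : Type*} [TopologicalSpace G] [ChartedSpace EG G] [Group G]
  {𝕜 : Type*} [RCLike 𝕜] {V : Type*} [NormedAddCommGroup V] [NormedSpace ℝ V] [Module 𝕜 V]
  [IsScalarTower ℝ 𝕜 V] [FiniteDimensional ℝ V]

/-- A representation of `G` on a finite dimensional vector space over `𝕜 = ℝ` or `ℂ`, as a
homomorphism into the continuous real linear endomorphisms. -/
def realRep (ρ : Representation 𝕜 G V) : G →* (V →L[ℝ] V) where
  toFun g := LinearMap.toContinuousLinearMap ((ρ g).restrictScalars ℝ)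
  map_one' := by ext v; simp
  map_mul' g h := by ext v; simp

/-- The restriction of a representation of `G` to the subgroup `P`. -/
def resRep (P : Subgroup G) (ρ : Representation 𝕜 G V) : P →* (V →L[ℝ] V) :=
  (realRep ρ).comp P.subtype

variable (EG)

/-- Representations of a Lie group are required to be smooth. -/
def IsSmoothRep (ρ : Representation 𝕜 G V) : Prop :=
  ContMDiff 𝓘(ℝ, EG) 𝓘(ℝ, V →L[ℝ] V) ∞ (realRep ρ)

/-- The infinitesimal representation `X ↦ (v ↦ X · v)` of `𝔤`, the derivative at `1` of the
representation of `G`. -/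
def infRep (ρ : Representation 𝕜 G V) : LieAlg EG G →L[ℝ] (V →L[ℝ] V) :=
  mfderiv 𝓘(ℝ, EG) 𝓘(ℝ, V →L[ℝ] V) (realRep ρ) 1

variable [FiniteDimensional ℝ EG] [LieGroup 𝓘(ℝ, EG) ∞ G]
  [LieAlgebra.IsSemisimple ℝ (LieAlg EG G)]

/-- The Casimir operator of a representation of `G`, `v ↦ ∑ ξ^ℓ · ξ_ℓ · v`, for bases `ξ^ℓ` and
`ξ_ℓ` of `𝔤` which are dual with respect to the Killing form. -/
def casimir (ρ : Representation 𝕜 G V) (v : V) : V :=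
  ∑ i, infRep EG ρ (lieBasis (LieAlg EG G) i) (infRep EG ρ (lieDualBasis (LieAlg EG G) i) v)

variable {EG}

/-- The Kostant codifferential `∂* : 𝔭₊ ⊗ V → V`, `Z ⊗ v ↦ -Z · v`, i.e. the Lie algebra homology
differential `Λ^k 𝔭₊ ⊗ V → Λ^(k-1) 𝔭₊ ⊗ V` in degree `k = 1`. -/
def kostantCodiff (p : Submodule ℝ (LieAlg EG G)) (ρ : Representation 𝕜 G V) :
    pPlus p ⊗[ℝ] V →ₗ[ℝ] V :=
  TensorProduct.lift
    (-((ContinuousLinearMap.coeLM ℝ).comp ((infRep EG ρ).toLinearMap.comp (pPlus p).subtype)))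

theorem kostantCodiff_tmul (p : Submodule ℝ (LieAlg EG G)) (ρ : Representation 𝕜 G V)
    (Z : pPlus p) (v : V) : kostantCodiff p ρ (Z ⊗ₜ v) = -(infRep EG ρ Z v) := by
  simp [kostantCodiff]

end Representations

section Tractor

variable {EG : Type*} [NormedAddCommGroup EG] [NormedSpace ℝ EG] [FiniteDimensional ℝ EG]
  {G : Type*} [TopologicalSpace G] [ChartedSpace EG G] [Group G] [LieGroup 𝓘(ℝ, EG) ∞ G]
  {P : Subgroup G} {EP : Type*} [NormedAddCommGroup EP] [NormedSpace ℝ EP]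
  [FiniteDimensional ℝ EP] [ChartedSpace EP P] [LieGroup 𝓘(ℝ, EP) ∞ P]
  {EB : Type*} [NormedAddCommGroup EB] [NormedSpace ℝ EB] [FiniteDimensional ℝ EB]
  {B : Type*} [TopologicalSpace B] [ChartedSpace EB B] [IsManifold 𝓘(ℝ, EB) ∞ B]
  {EM : Type*} [NormedAddCommGroup EM] [NormedSpace ℝ EM] [FiniteDimensional ℝ EM]
  {M : Type*} [TopologicalSpace M] [ChartedSpace EM M] [IsManifold 𝓘(ℝ, EM) ∞ M]
  {𝕜 : Type*} [RCLike 𝕜] {V : Type*} [NormedAddCommGroup V] [NormedSpace ℝ V] [Module 𝕜 V]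
  [IsScalarTower ℝ 𝕜 V] [FiniteDimensional ℝ V]
  {geo : CartanGeometry EG EP P EB B EM M} {ρ : Representation 𝕜 G V}

/-- In vertical directions the fundamental derivative is algebraic: `D_X σ = -X · σ` for
`X ∈ 𝔭`. -/
theorem constDeriv_of_mem (hP : IsParabolicSubgroup EG P EP) (hρ : IsSmoothRep EG ρ)
    (σ : NatSection geo (resRep P ρ)) (u : B) {X : LieAlg EG G} (hX : X ∈ lieSub EG P EP) :
    constDeriv geo σ.toFun u X = -(infRep EG ρ X (σ.toFun u)) := by
  obtain ⟨Y, rfl⟩ := hX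
  have hval : MDifferentiableAt 𝓘(ℝ, EP) 𝓘(ℝ, EG) (Subtype.val : P → G) 1 :=
    hP.isSmoothEmbedding.contMDiff.mdifferentiable (by simp) 1
  have hact : MDifferentiableAt 𝓘(ℝ, EP) 𝓘(ℝ, EB) (geo.act u) 1 :=
    (geo.smooth_act.comp (contMDiff_const.prodMk contMDiff_id)).mdifferentiable (by simp) 1
  have hσ : MDifferentiableAt 𝓘(ℝ, EB) 𝓘(ℝ, V) σ.toFun u :=
    σ.smooth.mdifferentiable (by simp) u
  have hrep : MDifferentiableAt 𝓘(ℝ, EG) 𝓘(ℝ, V →L[ℝ] V) (realRep ρ) 1 :=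
    hρ.mdifferentiable (by simp) 1
  have hA : MDifferentiableAt 𝓘(ℝ, EP) 𝓘(ℝ, V →L[ℝ] V) (realRep ρ ∘ (Subtype.val : P → G)) 1 :=
    MDifferentiableAt.comp_of_eq 1 hrep hval rfl
  have hS : MDifferentiableAt 𝓘(ℝ, EP) 𝓘(ℝ, V) (σ.toFun ∘ geo.act u) 1 :=
    MDifferentiableAt.comp_of_eq 1 hσ hact (geo.act_one u)
  have prod := mfderiv_clm_apply hA hS Y
  have hconst : (fun h => (realRep ρ ∘ (Subtype.val : P → G)) h ((σ.toFun ∘ geo.act u) h)) =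
      fun _ => σ.toFun u := by
    ext h
    have h1 := σ.equivariant u h
    have h2 : realRep ρ (h : G) (resRep P ρ h⁻¹ (σ.toFun u)) = σ.toFun u := by
      change (realRep ρ (h : G) * realRep ρ ((h⁻¹ : P) : G)) (σ.toFun u) = σ.toFun u
      rw [← map_mul]
      simp
    simp only [Function.comp_apply, h1, h2]
  rw [hconst, modelDeriv_const, mfderiv_chain hrep hval rfl,
    mfderiv_chain hσ hact (geo.act_one u)] at prod
  have aux : ∀ w, w = u → ∀ ξ : EB, geo.conn w ξ = geo.conn u ξ := by
    rintro _ rfl _; rfl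
  have hcf : (geo.conn u).symm (lieIncl EG P EP Y) = modelDeriv EP EB (geo.act u) 1 Y :=
    (geo.conn u).symm_apply_eq.2
      ((geo.conn_fundamental u Y).symm.trans (aux _ (geo.act_one u) _))
  have hd : constDeriv geo σ.toFun u (lieIncl EG P EP Y) =
      modelDeriv EB V σ.toFun u (modelDeriv EP EB (geo.act u) 1 Y) :=
    congrArg (modelDeriv EB V σ.toFun u) hcf
  have h0 : ((realRep ρ ∘ (Subtype.val : P → G)) 1 : V →L[ℝ] V) = 1 := by simp
  have hs1 : (σ.toFun ∘ geo.act u) 1 = σ.toFun u := by simp [geo.act_one]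
  rw [h0, hs1] at prod
  refine hd.trans (eq_neg_of_add_eq_zero_right ?_)
  exact prod.symm

/-- The tractor connection `∇^V : Γ(VM) → Γ(T*M ⊗ VM)`, where `TM = B ×_P (𝔤/𝔭)`: the operator
`(X, σ) ↦ D_X σ + X · σ`, which descends to `X ∈ 𝔤/𝔭`. -/
def tractorConnection (hP : IsParabolicSubgroup EG P EP) (hρ : IsSmoothRep EG ρ)
    (σ : NatSection geo (resRep P ρ)) (u : B) : LieAlg EG G ⧸ lieSub EG P EP →ₗ[ℝ] V :=
  (lieSub EG P EP).liftQ
    { toFun := fun X => (fundDeriv σ).toFun u X + infRep EG ρ X (σ.toFun u)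
      map_add' := fun X Y => by simp only [map_add, add_apply]; abel
      map_smul' := fun c X => by simp }
    fun X hX => by
      have := constDeriv_of_mem hP hρ σ u hX
      rw [LinearMap.mem_ker]
      change constDeriv geo σ.toFun u X + infRep EG ρ X (σ.toFun u) = 0
      rw [this, neg_add_cancel]

variable [LieAlgebra.IsSemisimple ℝ (LieAlg EG G)]

/-- The Kostant codifferential `∂* : T*M ⊗ VM → VM` applied to a one-form with values in `VM`, at a
point `u` of `B`. The cotangent bundle is `B ×_P 𝔭₊`, via `𝔭₊ ≅ (𝔤/𝔭)*`. -/
def codifferential (p : Submodule ℝ (LieAlg EG G)) (ρ : Representation 𝕜 G V)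
    (φ : B → (LieAlg EG G ⧸ p →ₗ[ℝ] V)) (u : B) : V :=
  kostantCodiff p ρ ((pPlusTensorEquiv p V).symm (φ u))

end Tractor

end

end CurvedCasimir

open CurvedCasimir

namespace CurvedCasimir

noncomputable section

/-! ### Dual frames of `𝔭₊` and `𝔤/𝔭`, and contraction with the Killing form -/

section DualFrame

variable {L : Type*} [LieRing L] [LieAlgebra ℝ L] [FiniteDimensional ℝ L]
  [LieAlgebra.IsSemisimple ℝ L]

/-! Fix a point `u` of the bundle, put `s = σ(u)`, and write `D_X D_Y σ` for `D²σ(u)(X, Y)`. Let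
`N(X) = D_X σ + X·s` be the tractor connection, which vanishes on `𝔭`, and set `S(X, Y) = D_X D_Y σ
+ Y·D_X σ`. Then `D_X D_Y σ = S(X, Y) - Y·N(X) + Y·X·s`, and the three terms are contracted with the
Killing form `B` separately.

The last term gives the Casimir operator, since the contraction does not see the order of the
arguments. The other two, the second after exchanging its arguments, vanish when the second argument
lies in `𝔭`. They may therefore be contracted in a basis `b_j` of `𝔭₊` and representatives `x_j` of
the dual basis of `𝔤/𝔭` (`killingContract_eq_sum_of_vanish`). The middle term becomes `-∑ b_j·N(x_j)
= ∂*∇σ`. For the first, `b_j ∈ 𝔭₊ ⊆ 𝔭` and equivariance of `Dσ` under `P` give `S(Z, X) = -Z·N(X) +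
N([Z, X])` for `Z ∈ 𝔭`; hence it contributes a second `∂*∇σ` and the error `N(∑ [b_j, x_j])`.

The error is zero because `∑ [b_j, x_j] ∈ 𝔭` (`sum_lie_dual_frame_mem`): its pairing with `b_k` is
the trace of `ad b_k` on `𝔭₊`, which vanishes as `b_k ∈ [𝔭, 𝔭]`. The inclusions `𝔭₊ ⊆ 𝔭` and `𝔭₊ ⊆
span [𝔭, 𝔭]` come from the root decomposition of the complexification
(`IsParabolicSubalgebra.pPlus_le`).

The formula for `S(Z, X)` also needs two facts on Lie groups: the derivative of `Ad` at the unit is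
the bracket (`modelDeriv_Ad`), and the derivative of a smooth representation is a representation of
`𝔤` (`infRep_lie`). -/

theorem pPlusEquiv_apply_mk (p : Submodule ℝ L) (Z : pPlus p) (X : L) :
    pPlusEquiv p Z (Submodule.Quotient.mk X) = killingForm ℝ L Z X := rfl

/-- Representatives of the basis of `𝔤/𝔭` dual to a basis of `𝔭₊`. -/
theorem exists_dual_frame (p : Submodule ℝ L) {ι : Type*} [Fintype ι] [DecidableEq ι]
    (b : Module.Basis ι ℝ (pPlus p)) :
    ∃ x : ι → L, (∀ j k, killingForm ℝ L (b j) (x k) = if j = k then 1 else 0) ∧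
      ∀ Y, Y - ∑ j, killingForm ℝ L (b j) Y • x j ∈ p := by
  let d := b.map (pPlusEquiv p)
  -- The dual basis of `d` a priori lives in the bidual of `𝔤/𝔭`; finite dimensionality brings it
  -- back to `𝔤/𝔭`.
  let c : ι → L ⧸ p := fun k => (Module.evalEquiv ℝ (L ⧸ p)).symm (d.coord k)
  have hc : ∀ f k, f (c k) = d.repr f k := by
    intro f k
    have := LinearMap.congr_fun ((Module.evalEquiv ℝ (L ⧸ p)).apply_symm_apply (d.coord k)) f
    exact this
  choose x hx using fun k => Submodule.Quotient.mk_surjective p (c k)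
  have h1 : ∀ j k, killingForm ℝ L (b j) (x k) = if j = k then 1 else 0 := by
    intro j k
    rw [← pPlusEquiv_apply_mk, hx, hc]
    have : pPlusEquiv p (b j) = d j := by simp [d]
    rw [this, d.repr_self, Finsupp.single_apply]
  refine ⟨x, h1, fun Y => ?_⟩
  rw [← Submodule.Quotient.mk_eq_zero]
  -- A vector of `𝔤/𝔭` is zero once every functional of the basis `d` kills it.
  apply (Module.evalEquiv ℝ (L ⧸ p)).injective
  refine d.ext fun k => ?_
  simp only [Module.evalEquiv_apply, map_zero, LinearMap.zero_apply, Module.Dual.eval_apply]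
  have : d k = pPlusEquiv p (b k) := by simp [d]
  rw [this, pPlusEquiv_apply_mk]
  simp [h1]

variable {p : Submodule ℝ L} {ι : Type*} [Fintype ι] [DecidableEq ι]
  {b : Module.Basis ι ℝ (pPlus p)} {x : ι → L}

theorem repr_eq_killingForm
    (h : ∀ j k, killingForm ℝ L (b j) (x k) = if j = k then 1 else 0) (Z : pPlus p) (k : ι) :
    b.repr Z k = killingForm ℝ L Z (x k) := by
  conv_rhs => rw [← b.sum_repr Z]
  simp [h, -Module.Basis.sum_repr]

/-- A bilinear map which vanishes on `𝔭` in the second argument may be contracted in a basis of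
`𝔭₊` and a dual frame of `𝔤/𝔭`. -/
theorem killingContract_eq_sum_of_vanish {W : Type*} [AddCommGroup W] [Module ℝ W]
    (hx : ∀ Y, Y - ∑ j, killingForm ℝ L (b j) Y • x j ∈ p)
    (T : L →ₗ[ℝ] L →ₗ[ℝ] W) (hT : ∀ X, ∀ Y ∈ p, T X Y = 0) :
    killingContract T = ∑ j, T (b j) (x j) := by
  have e : ∀ X : L, X = ∑ i, killingForm ℝ L X (lieDualBasis L i) • lieBasis L i := by
    intro X
    conv_lhs => rw [← (lieBasis L).sum_repr X]
    refine Finset.sum_congr rfl fun j _ => ?_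
    congr 1
    have := congrArg (fun Z => killingForm ℝ L Z (lieDualBasis L j)) ((lieBasis L).sum_repr X)
    simpa [killingForm_lieBasis, -Module.Basis.sum_repr] using this
  have s : killingContract T =
      ∑ i, ∑ j, killingForm ℝ L (b j) (lieDualBasis L i) • T (lieBasis L i) (x j) := by
    refine Finset.sum_congr rfl fun i _ => ?_
    -- Modulo `𝔭`, `ξ_i` is `∑ B(b_j, ξ_i) x_j`. After exchanging the sums, `∑ B(b_j, ξ_i) ξ^i =
    -- b_j` finishes.
    have := hT (lieBasis L i) _ (hx (lieDualBasis L i))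
    rw [map_sub, sub_eq_zero] at this
    rw [this]
    simp
  rw [s, Finset.sum_comm]
  refine Finset.sum_congr rfl fun j _ => ?_
  conv_rhs => rw [e (b j : L)]
  simp

/-- Since `B` is symmetric, exchanging the two members of a dual pair of bases gives a dual pair
again. -/
theorem killingContract_flip {W : Type*} [AddCommGroup W] [Module ℝ W]
    (T : L →ₗ[ℝ] L →ₗ[ℝ] W) : killingContract T.flip = killingContract T := by
  rw [killingContract_eq T.flip (lieDualBasis L) (lieBasis L)]
  · rfl
  · intro i j
    rw [LieModule.traceForm_comm, killingForm_lieBasis]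
    simp [eq_comm]

/-- Expands a `W`-valued form on `𝔤/𝔭` in the dual frame, so that the codifferential can be
evaluated term by term. -/
theorem pPlusTensorEquiv_symm_apply {W : Type*} [AddCommGroup W] [Module ℝ W]
    (hx : ∀ Y, Y - ∑ j, killingForm ℝ L (b j) Y • x j ∈ p) (φ : L ⧸ p →ₗ[ℝ] W) :
    (pPlusTensorEquiv p W).symm φ = ∑ j, b j ⊗ₜ φ (Submodule.Quotient.mk (x j)) := by
  rw [LinearEquiv.symm_apply_eq, map_sum]
  ext Y
  have := (Submodule.Quotient.mk_eq_zero p).2 (hx Y)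
  rw [Submodule.Quotient.mk_sub, sub_eq_zero] at this
  change φ (Submodule.Quotient.mk Y) = _
  rw [this]
  simp only [LinearMap.coe_comp, Function.comp_apply, LinearMap.sum_apply, Submodule.mkQ_apply]
  rw [← Submodule.mkQ_apply, map_sum, map_sum]
  refine Finset.sum_congr rfl fun j _ => ?_
  rw [map_smul, map_smul]
  rfl

/-- Elements of `[𝔭, 𝔭]` act on `𝔭₊` with trace zero. -/
theorem sum_killingForm_lie_eq_zero (hp : ∀ a ∈ p, ∀ c ∈ p, ⁅a, c⁆ ∈ p)
    (h : ∀ j k, killingForm ℝ L (b j) (x k) = if j = k then 1 else 0) {W : L}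
    (hW : W ∈ Submodule.span ℝ {z | ∃ a ∈ p, ∃ c ∈ p, ⁅a, c⁆ = z}) :
    ∑ j, killingForm ℝ L ⁅W, (b j : L)⁆ (x j) = 0 := by
  have stable : ∀ a ∈ p, ∀ Z ∈ pPlus p, LieAlgebra.ad ℝ L a Z ∈ pPlus p := by
    intro a ha Z hZ
    rw [mem_pPlus_iff] at hZ ⊢
    intro X hX
    rw [LieAlgebra.ad_apply, ← lie_skew, map_neg, LinearMap.neg_apply,
      LieModule.traceForm_apply_lie_apply, hZ _ (hp a ha X hX), neg_zero]
  -- The `j`-th coordinate on `𝔭₊` is pairing with `x j`, so the sum in question is a trace. For a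
  -- bracket it is the trace of a commutator of endomorphisms of `𝔭₊`.
  have tr : ∀ f : Module.End ℝ (pPlus p),
      LinearMap.trace ℝ _ f = ∑ j, killingForm ℝ L (f (b j)) (x j) := by
    intro f
    rw [LinearMap.trace_eq_matrix_trace ℝ b, Matrix.trace]
    refine Finset.sum_congr rfl fun j _ => ?_
    rw [Matrix.diag_apply, LinearMap.toMatrix_apply, repr_eq_killingForm h]
  induction hW using Submodule.span_induction with
  | mem z hz =>
    obtain ⟨a, ha, c, hc, rfl⟩ := hz
    let A := (LieAlgebra.ad ℝ L a).restrict (stable a ha)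
    let C := (LieAlgebra.ad ℝ L c).restrict (stable c hc)
    have := tr (A * C - C * A)
    rw [map_sub, LinearMap.trace_mul_comm, sub_self] at this
    rw [this]
    refine Finset.sum_congr rfl fun j _ => ?_
    rw [lie_lie]
    rfl
  | zero => simp
  | add y z _ _ hy hz => simp [Finset.sum_add_distrib, hy, hz]
  | smul c y _ hy => simp [← Finset.mul_sum, hy]

/-- By the dual frame, an element lies in `𝔭` as soon as it is orthogonal to all `b_k`. Invariance
turns `B(b_k, ∑ [b_j, x_j])` into `∑ B([b_k, b_j], x_j)`, the trace of `ad b_k` on `𝔭₊`. -/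
theorem sum_lie_dual_frame_mem (hp : ∀ a ∈ p, ∀ c ∈ p, ⁅a, c⁆ ∈ p)
    (hpp : pPlus p ≤ Submodule.span ℝ {z | ∃ a ∈ p, ∃ c ∈ p, ⁅a, c⁆ = z})
    (h : ∀ j k, killingForm ℝ L (b j) (x k) = if j = k then 1 else 0)
    (hx : ∀ Y, Y - ∑ j, killingForm ℝ L (b j) Y • x j ∈ p) :
    ∑ j, ⁅(b j : L), x j⁆ ∈ p := by
  have := hx (∑ j, ⁅(b j : L), x j⁆)
  have h0 : ∀ k, killingForm ℝ L (b k) (∑ j, ⁅(b j : L), x j⁆) = 0 := by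
    intro k
    rw [map_sum, ← sum_killingForm_lie_eq_zero hp h (hpp (b k).2)]
    refine Finset.sum_congr rfl fun j _ => ?_
    rw [LieModule.traceForm_apply_lie_apply]
  simpa [h0] using this

end DualFrame

/-! ### Root decomposition: `𝔭₊` lies in `𝔭` and in the span of `[𝔭, 𝔭]` -/

section Parabolic

open LieAlgebra LieModule

/-- An element orthogonal to a Cartan subalgebra and to all positive root spaces is a sum of
positive root vectors. -/
theorem mem_iSup_pos_of_orthogonal {K A : Type*} [Field K] [CharZero K] [LieRing A] [LieAlgebra K A]
    [FiniteDimensional K A] [IsKilling K A] (H : LieSubalgebra K A) [H.IsCartanSubalgebra]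
    [IsTriangularizable K H A] {Pos : Set (H → K)}
    (hPos : ∀ α : H → K, α ≠ 0 → rootSpace H α ≠ ⊥ → Xor (α ∈ Pos) (-α ∈ Pos)) {w : A}
    (h0 : ∀ y ∈ H, killingForm K A w y = 0)
    (hw : ∀ α ∈ Pos, ∀ y ∈ rootSpace H α, killingForm K A w y = 0) :
    w ∈ ⨆ α ∈ Pos, (rootSpace H α).toSubmodule := by
  have htop : w ∈ ⨆ α : H → K, (rootSpace H α).toSubmodule := by
    rw [LieSubmodule.iSup_toSubmodule_eq_top.mpr <| iSup_genWeightSpace_eq_top K H A]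
    trivial
  obtain ⟨f, hf, rfl⟩ := (Submodule.mem_iSup_iff_exists_finsupp _ _).1 htop
  refine Submodule.sum_mem _ fun α _ => ?_
  by_cases hα : α ∈ Pos
  · exact Submodule.mem_iSup_of_mem α (Submodule.mem_iSup_of_mem hα (hf α))
  suffices f α = 0 by rw [this]; exact Submodule.zero_mem _
  by_cases hbot : rootSpace H α = ⊥
  · have := hf α
    rw [hbot] at this
    simpa using this
  -- A component in the root space of `α` is zero if it is orthogonal to the root space of `-α`.
  -- That space pairs with `w` only through this component, and it is either the Cartan subalgebra
  -- (`α = 0`) or a positive root space.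
  have hker := mem_ker_killingForm_of_mem_rootSpace_of_forall_rootSpace_neg K A H (hf α) ?_
  · rw [IsKilling.ker_killingForm_eq_bot] at hker
    simpa using hker
  intro y hy
  have hsum : killingForm K A (f.sum fun _ v => v) y = killingForm K A (f α) y := by
    rw [Finsupp.sum, map_sum, LinearMap.sum_apply]
    refine Finset.sum_eq_single α (fun β _ hβ => ?_) fun hα' => ?_
    · refine killingForm_apply_eq_zero_of_mem_rootSpace_of_add_ne_zero K A H (hf β) hy fun e => hβ ?_
      rwa [← sub_eq_add_neg, sub_eq_zero] at e
    · rw [Finsupp.notMem_support_iff.1 hα']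
      simp
  rw [← hsum]
  by_cases hα0 : α = 0
  · refine h0 y ?_
    rw [hα0, neg_zero, rootSpace_zero_eq] at hy
    exact hy
  · exact hw (-α) (((hPos α hα0 hbot).or).resolve_left hα) y hy

variable {L : Type*} [LieRing L] [LieAlgebra ℝ L]

theorem lie_mem_baseChange_span (p : Submodule ℝ L) {y z : ℂ ⊗[ℝ] L} (hy : y ∈ p.baseChange ℂ)
    (hz : z ∈ p.baseChange ℂ) :
    LieAlgebra.ad ℂ (ℂ ⊗[ℝ] L) y z ∈
      (Submodule.span ℝ {z | ∃ a ∈ p, ∃ c ∈ p, ⁅a, c⁆ = z}).baseChange ℂ := by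
  rw [Submodule.baseChange_eq_span] at hy hz
  induction hy using Submodule.span_induction with
  | mem y hy =>
    obtain ⟨a, ha, rfl⟩ := hy
    induction hz using Submodule.span_induction with
    | mem z hz =>
      obtain ⟨c, hc, rfl⟩ := hz
      have e : LieAlgebra.ad ℂ (ℂ ⊗[ℝ] L) (1 ⊗ₜ a) (1 ⊗ₜ c) = 1 ⊗ₜ ⁅a, c⁆ :=
        (LieAlgebra.ExtendScalars.bracket_tmul ℝ ℂ L L 1 1 a c).trans (by rw [one_mul])
      rw [TensorProduct.mk_apply, TensorProduct.mk_apply, e]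
      exact Submodule.tmul_mem_baseChange_of_mem _ (Submodule.subset_span ⟨a, ha, c, hc, rfl⟩)
    | zero => rw [map_zero]; exact Submodule.zero_mem _
    | add _ _ _ _ h1 h2 => rw [map_add]; exact Submodule.add_mem _ h1 h2
    | smul t _ _ h => rw [map_smul]; exact Submodule.smul_mem _ t h
  | zero => rw [map_zero]; exact Submodule.zero_mem _
  | add _ _ _ _ h1 h2 => rw [map_add]; exact Submodule.add_mem _ h1 h2
  | smul t _ _ h => rw [map_smul]; exact Submodule.smul_mem _ t h

theorem killingForm_one_tmul [FiniteDimensional ℝ L] (a c : L) :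
    killingForm ℂ (ℂ ⊗[ℝ] L) (1 ⊗ₜ a) (1 ⊗ₜ c) = ((killingForm ℝ L a c : ℝ) : ℂ) := by
  have e : killingForm ℂ (ℂ ⊗[ℝ] L) = (killingForm ℝ L).baseChange ℂ :=
    LieModule.traceForm_baseChange ..
  rw [e, LinearMap.BilinForm.baseChange_tmul]
  simp

variable [FiniteDimensional ℝ L] [LieAlgebra.IsSemisimple ℝ L]

/-- The basis `1 ⊗ ξ^i` has the dual family `1 ⊗ ξ_j`, so pairing an element of the radical with `1
⊗ ξ_j` reads off its `j`-th coordinate, which must vanish. -/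
instance isKilling_complexification : IsKilling ℂ (ℂ ⊗[ℝ] L) where
  killingCompl_top_eq_bot := by
    rw [LieSubmodule.eq_bot_iff]
    intro w hw
    rw [LieIdeal.mem_killingCompl] at hw
    let b := (lieBasis L).baseChange ℂ
    have hb : ∀ i, b i = 1 ⊗ₜ lieBasis L i := fun i => Module.Basis.baseChange_apply ..
    rw [← b.sum_repr w]
    refine Finset.sum_eq_zero fun j _ => ?_
    have := hw (1 ⊗ₜ lieDualBasis L j) trivial
    rw [LieModule.traceForm_comm, ← b.sum_repr w] at this
    simp only [map_sum, map_smul, LinearMap.sum_apply, LinearMap.smul_apply, hb,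
      killingForm_one_tmul, killingForm_lieBasis] at this
    simp only [smul_eq_mul, apply_ite Complex.ofReal, Complex.ofReal_one, Complex.ofReal_zero,
      mul_ite, mul_one, mul_zero, Finset.sum_ite_eq', Finset.mem_univ, if_true] at this
    rw [this, zero_smul]

variable {p : Submodule ℝ L}

theorem killingForm_baseChange_pPlus {w y : ℂ ⊗[ℝ] L} (hw : w ∈ (pPlus p).baseChange ℂ)
    (hy : y ∈ p.baseChange ℂ) : killingForm ℂ (ℂ ⊗[ℝ] L) w y = 0 := by
  rw [Submodule.baseChange_eq_span] at hw hy
  induction hw using Submodule.span_induction with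
  | mem w hw =>
    obtain ⟨a, ha, rfl⟩ := hw
    induction hy using Submodule.span_induction with
    | mem z hz =>
      obtain ⟨c, hc, rfl⟩ := hz
      simp only [TensorProduct.mk_apply, killingForm_one_tmul]
      simp [(mem_pPlus_iff p a).1 ha c hc]
    | zero => simp
    | add _ _ _ _ h1 h2 => rw [map_add, h1, h2, add_zero]
    | smul t _ _ h => rw [map_smul, h, smul_zero]
  | zero => simp
  | add _ _ _ _ h1 h2 => rw [map_add, LinearMap.add_apply, h1, h2, add_zero]
  | smul t _ _ h => rw [map_smul, LinearMap.smul_apply, h, smul_zero]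

/-- After complexification `𝔭₊` is orthogonal to the Cartan subalgebra and to the positive root
spaces, hence is contained in the sum of the latter. Inclusions of real subspaces can be tested on
their complexifications. -/
theorem IsParabolicSubalgebra.pPlus_le (hp : IsParabolicSubalgebra p) :
    pPlus p ≤ p ∧ pPlus p ≤ Submodule.span ℝ {z | ∃ a ∈ p, ∃ c ∈ p, ⁅a, c⁆ = z} := by
  obtain ⟨H, _, Pos, hPos, hxor, -, hH, hle⟩ := hp
  have key : (pPlus p).baseChange ℂ ≤ ⨆ α ∈ Pos, (rootSpace H α).toSubmodule := fun w hw =>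
    mem_iSup_pos_of_orthogonal H hxor
      (fun y hy => killingForm_baseChange_pPlus hw (hH hy))
      fun α hα y hy => killingForm_baseChange_pPlus hw (hle α hα hy)
  constructor
  · rw [← Submodule.baseChange_le_iff (A := ℂ)]
    exact key.trans (iSup₂_le hle)
  · rw [← Submodule.baseChange_le_iff (A := ℂ)]
    refine key.trans (iSup₂_le fun α hα y hy => ?_)
    -- A root is nonzero, so some `h` in the Cartan subalgebra has `α h ≠ 0`, and `y = (α h)⁻¹ [h,
    -- y]` is a multiple of a bracket.
    obtain ⟨h, hh⟩ := Function.ne_iff.1 (hPos α hα).1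
    have e : LieAlgebra.ad ℂ (ℂ ⊗[ℝ] L) h y = α h • y := IsKilling.lie_eq_smul_of_mem_rootSpace hy h
    rw [← inv_smul_smul₀ hh y, ← e]
    exact Submodule.smul_mem _ _ (lie_mem_baseChange_span p (hH h.2) (hle α hα hy))

end Parabolic

/-! ### Second derivatives of a local group law -/

section LocalGroup

open Filter Topology

variable {E : Type*} [NormedAddCommGroup E] [NormedSpace ℝ E]

/-- Here `k` selects the slot of the first differentiation and `l` is the direction in which the
base point moves; the result is the second derivative on `l` and `k`. -/
theorem hasFDerivAt_partial_deriv {F : Type*} [NormedAddCommGroup F] [NormedSpace ℝ F]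
    {f : E × E → F} {e : E} (hf : ContDiffAt ℝ 2 f (e, e)) (k l : E →L[ℝ] E × E) {j : E → E × E}
    (hj : HasFDerivAt j l e) (hje : j e = (e, e)) :
    HasFDerivAt (fun x => (fderiv ℝ f (j x)).comp k)
      (((ContinuousLinearMap.compL ℝ E (E × E) F).flip k).comp
        ((fderiv ℝ (fderiv ℝ f) (e, e)).comp l)) e := by
  have h : HasFDerivAt (fderiv ℝ f) (fderiv ℝ (fderiv ℝ f) (e, e)) (j e) := by
    rw [hje]
    exact ((hf.fderiv_right (m := 1) (by norm_num)).differentiableAt (by simp)).hasFDerivAt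
  exact ((ContinuousLinearMap.compL ℝ E (E × E) F).flip k).hasFDerivAt.comp e (h.comp e hj)

/-- For a local group law `μ` with conjugation `c(x, y) = x y x⁻¹`, the second mixed derivative of
`c` at the unit is the skew-symmetrization of that of `μ`. -/
theorem fderiv_partial_conj {μ c : E × E → E} {e : E} (hμ : ContDiffAt ℝ 2 μ (e, e))
    (hc : ContDiffAt ℝ 2 c (e, e)) (hμe : ∀ᶠ x in 𝓝 e, μ (x, e) = x)
    (hce : ∀ᶠ x in 𝓝 e, c (x, e) = e) (hec : ∀ᶠ y in 𝓝 e, c (e, y) = y)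
    (hrel : ∀ᶠ z in 𝓝 (e, e), μ z = μ (c z, z.1)) (X Y : E) :
    fderiv ℝ (fun x => (fderiv ℝ c (x, e)).comp (ContinuousLinearMap.inr ℝ E E)) e X Y =
      fderiv ℝ (fun x => (fderiv ℝ μ (x, e)).comp (ContinuousLinearMap.inr ℝ E E)) e X Y -
      fderiv ℝ (fun x => (fderiv ℝ μ (x, e)).comp (ContinuousLinearMap.inr ℝ E E)) e Y X := by
  let i₁ := ContinuousLinearMap.inl ℝ E E
  let i₂ := ContinuousLinearMap.inr ℝ E E
  have j₁ : HasFDerivAt (fun x : E => (x, e)) i₁ e := hasFDerivAt_prodMk_left e e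
  have j₂ : HasFDerivAt (fun x : E => (e, x)) i₂ e := hasFDerivAt_prodMk_right e e
  have hL := hasFDerivAt_partial_deriv hμ i₂ i₁ j₁ rfl
  have hR := hasFDerivAt_partial_deriv hμ i₁ i₂ j₂ rfl
  have hA := hasFDerivAt_partial_deriv hc i₂ i₁ j₁ rfl
  have hcont : Tendsto (fun x : E => (x, e)) (𝓝 e) (𝓝 (e, e)) :=
    j₁.continuousAt
  have hcont₂ : Tendsto (fun x : E => (e, x)) (𝓝 e) (𝓝 (e, e)) :=
    j₂.continuousAt
  have dμ : ∀ᶠ z in 𝓝 (e, e), DifferentiableAt ℝ μ z :=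
    (hμ.eventually (by simp)).mono fun z hz => hz.differentiableAt (by simp)
  have dc : ∀ᶠ z in 𝓝 (e, e), DifferentiableAt ℝ c z :=
    (hc.eventually (by simp)).mono fun z hz => hz.differentiableAt (by simp)
  -- Differentiating `xy = (x y x⁻¹) x` in `y` at the unit gives `∂₂μ(x, e) = ∂₁μ(e, x) ∘ ∂₂c(x,
  -- e)`. This is then differentiated in `x`; both factors on the right are the identity at `x = e`.
  have key : (fun x => (fderiv ℝ μ (x, e)).comp i₂) =ᶠ[𝓝 e]
      fun x => ((fderiv ℝ μ (e, x)).comp i₁).comp ((fderiv ℝ c (x, e)).comp i₂) := by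
    filter_upwards [hcont.eventually hrel.eventually_nhds, hcont.eventually dc,
      hcont₂.eventually dμ, hce] with x hx hdc hdμ hcx
    have h1 : HasFDerivAt (fun z : E × E => (c z, z.1))
        ((fderiv ℝ c (x, e)).prod (ContinuousLinearMap.fst ℝ E E)) (x, e) :=
      hdc.hasFDerivAt.prodMk hasFDerivAt_fst
    have h2 : HasFDerivAt μ (fderiv ℝ μ (e, x)) (c (x, e), x) := by
      rw [hcx]; exact hdμ.hasFDerivAt
    have h3 := h2.comp (x, e) h1
    rw [(h3.congr_of_eventuallyEq hx).fderiv]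
    ext v
    simp [i₁, i₂]
  have hR1 : (fderiv ℝ μ (e, e)).comp i₁ = ContinuousLinearMap.id ℝ E := by
    have h := HasFDerivAt.comp (f := fun x : E => (x, e)) e
      (hμ.differentiableAt (by simp)).hasFDerivAt j₁
    exact h.unique ((hasFDerivAt_id e).congr_of_eventuallyEq hμe)
  have hA1 : (fderiv ℝ c (e, e)).comp i₂ = ContinuousLinearMap.id ℝ E := by
    have h := HasFDerivAt.comp (f := fun x : E => (e, x)) e
      (hc.differentiableAt (by simp)).hasFDerivAt j₂
    exact h.unique ((hasFDerivAt_id e).congr_of_eventuallyEq hec)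
  have hprod := hR.clm_comp hA
  have hun := hL.unique (hprod.congr_of_eventuallyEq key)
  have hsym : IsSymmSndFDerivAt ℝ μ (e, e) := hμ.isSymmSndFDerivAt (by simp)
  rw [hA.fderiv, hL.fderiv]
  have h := DFunLike.congr_fun (DFunLike.congr_fun hun X) Y
  rw [hR1, hA1] at h
  simp only [ContinuousLinearMap.comp_apply, ContinuousLinearMap.flip_apply,
    ContinuousLinearMap.compL_apply, add_apply,
    ContinuousLinearMap.id_apply] at h ⊢
  -- Symmetry of the second derivative of `μ` identifies the term from `∂₁μ(e, x)` with the mixed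
  -- derivative at exchanged arguments.
  rw [h, hsym.eq (i₁ Y) (i₂ X)]
  abel

end LocalGroup

/-! ### Left invariant fields and `Ad` in the chart at the unit -/

section AdDeriv

open Filter Topology

theorem modelDeriv_eq_fderiv {E₁ E₂ : Type*} [NormedAddCommGroup E₁] [NormedSpace ℝ E₁]
    [NormedAddCommGroup E₂] [NormedSpace ℝ E₂] {M₁ M₂ : Type*} [TopologicalSpace M₁]
    [ChartedSpace E₁ M₁] [TopologicalSpace M₂] [ChartedSpace E₂ M₂] {f : M₁ → M₂} {x : M₁} {y : M₂}
    (hf : MDifferentiableAt 𝓘(ℝ, E₁) 𝓘(ℝ, E₂) f x) (hy : f x = y) :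
    modelDeriv E₁ E₂ f x = fderiv ℝ (extChartAt 𝓘(ℝ, E₂) y ∘ f ∘ (extChartAt 𝓘(ℝ, E₁) x).symm)
      (extChartAt 𝓘(ℝ, E₁) x x) := by
  subst hy
  simp only [modelDeriv]
  rw [hf.mfderiv, ModelWithCorners.range_eq_univ, fderivWithin_univ]
  rfl

variable {E : Type*} [NormedAddCommGroup E] [NormedSpace ℝ E]
  {G : Type*} [TopologicalSpace G] [ChartedSpace E G] [Group G] [LieGroup 𝓘(ℝ, E) ∞ G]

variable (E G) in
/-- The preferred chart at the unit. -/
abbrev unitChart : PartialEquiv G E := extChartAt 𝓘(ℝ, E) (1 : G)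

variable (E) in
/-- The expression of a map `G × G → G` in the chart at the unit. -/
def inUnitChart (F : G → G → G) (z : E × E) : E :=
  unitChart E G (F ((unitChart E G).symm z.1) ((unitChart E G).symm z.2))

variable (E G) in
theorem isManifold_lieGroup : IsManifold 𝓘(ℝ, E) ∞ G :=
  ContMDiffMul.toIsManifold

theorem unitChart_symm_unit : (unitChart E G).symm (unitChart E G 1) = 1 :=
  extChartAt_to_inv (1 : G)

theorem contMDiffAt_unitChart_symm {x : E} (hx : x ∈ (unitChart E G).target) :
    ContMDiffAt 𝓘(ℝ, E) 𝓘(ℝ, E) ∞ (unitChart E G).symm x :=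
  haveI := isManifold_lieGroup E G
  (contMDiffOn_extChartAt_symm (1 : G)).contMDiffAt ((isOpen_extChartAt_target 1).mem_nhds hx)

theorem contMDiffAt_unitChart {g : G} (hg : g ∈ (unitChart E G).source) :
    ContMDiffAt 𝓘(ℝ, E) 𝓘(ℝ, E) ∞ (unitChart E G) g :=
  haveI := isManifold_lieGroup E G
  contMDiffAt_extChartAt' (by simpa using hg)

theorem contDiffAt_inUnitChart {F : G → G → G}
    (hF : ContMDiff (𝓘(ℝ, E).prod 𝓘(ℝ, E)) 𝓘(ℝ, E) ∞ fun z : G × G => F z.1 z.2) {z : E × E}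
    (h₁ : z.1 ∈ (unitChart E G).target) (h₂ : z.2 ∈ (unitChart E G).target)
    (h : F ((unitChart E G).symm z.1) ((unitChart E G).symm z.2) ∈ (unitChart E G).source) :
    ContDiffAt ℝ ∞ (inUnitChart E F) z := by
  rw [← contMDiffAt_iff_contDiffAt]
  have a₁ : ContMDiffAt 𝓘(ℝ, E × E) 𝓘(ℝ, E) ∞ (fun z : E × E => (unitChart E G).symm z.1) z :=
    (contMDiffAt_unitChart_symm h₁).comp z contDiff_fst.contMDiff.contMDiffAt
  have a₂ : ContMDiffAt 𝓘(ℝ, E × E) 𝓘(ℝ, E) ∞ (fun z : E × E => (unitChart E G).symm z.2) z :=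
    (contMDiffAt_unitChart_symm h₂).comp z contDiff_snd.contMDiff.contMDiffAt
  have a := hF.contMDiffAt.comp z (a₁.prodMk a₂)
  exact ContMDiffAt.comp z (contMDiffAt_unitChart h) a

theorem contDiffAt_inUnitChart_unit {F : G → G → G}
    (hF : ContMDiff (𝓘(ℝ, E).prod 𝓘(ℝ, E)) 𝓘(ℝ, E) ∞ fun z : G × G => F z.1 z.2)
    (h : F 1 1 = 1) :
    ContDiffAt ℝ ∞ (inUnitChart E F) (unitChart E G 1, unitChart E G 1) := by
  refine contDiffAt_inUnitChart hF (mem_extChartAt_target (1 : G)) (mem_extChartAt_target (1 : G)) ?_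
  rw [unitChart_symm_unit, h]
  exact mem_extChartAt_source (1 : G)

theorem contMDiff_uncurry_mul :
    ContMDiff (𝓘(ℝ, E).prod 𝓘(ℝ, E)) 𝓘(ℝ, E) ∞ fun z : G × G => z.1 * z.2 :=
  contMDiff_mul 𝓘(ℝ, E) ∞

theorem contMDiff_uncurry_conj :
    ContMDiff (𝓘(ℝ, E).prod 𝓘(ℝ, E)) 𝓘(ℝ, E) ∞ fun z : G × G => z.1 * z.2 * z.1⁻¹ :=
  (contMDiff_uncurry_mul).mul (contMDiff_fst.inv)

theorem eventually_mem_unitChart_target :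
    ∀ᶠ x in 𝓝 (unitChart E G 1), x ∈ (unitChart E G).target :=
  extChartAt_target_mem_nhds (1 : G)

/-- The derivative of the group law in the second argument computes left invariant fields. -/
theorem mpullbackWithin_mulInvariantVectorField (Y : GroupLieAlgebra 𝓘(ℝ, E) G) {x : E}
    (hx : x ∈ (unitChart E G).target)
    (hd : DifferentiableAt ℝ (inUnitChart E (fun g h : G => g * h)) (x, unitChart E G 1)) :
    VectorField.mpullbackWithin 𝓘(ℝ, E) 𝓘(ℝ, E) (unitChart E G).symm (mulInvariantVectorField Y)
      (Set.range 𝓘(ℝ, E)) x =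
    (fderiv ℝ (inUnitChart E (fun g h : G => g * h)) (x, unitChart E G 1)).comp
      (ContinuousLinearMap.inr ℝ E E) Y := by
  have := isManifold_lieGroup E G
  have : IsManifold 𝓘(ℝ, E) 1 G := IsManifold.of_le (n := ∞) (by simp)
  set g := (unitChart E G).symm x with hg
  have hgs : g ∈ (unitChart E G).source := (unitChart E G).map_target hx
  -- Pulling back along the inverse chart is applying the derivative of the chart, which reduces the
  -- claim to the chain rule for the chart after left translation by `g`.
  have hinv : (mfderivWithin 𝓘(ℝ, E) 𝓘(ℝ, E) (unitChart E G).symm (Set.range 𝓘(ℝ, E)) x).inverse =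
      mfderiv 𝓘(ℝ, E) 𝓘(ℝ, E) (unitChart E G) g :=
    ContinuousLinearMap.inverse_eq (mfderivWithin_extChartAt_symm_comp_mfderiv_extChartAt hx)
      (mfderiv_extChartAt_comp_mfderivWithin_extChartAt_symm hx)
  rw [VectorField.mpullbackWithin_apply, hinv]
  have hmul : MDifferentiableAt 𝓘(ℝ, E) 𝓘(ℝ, E) (fun h : G => g * h) 1 :=
    (contMDiff_mul_left (I := 𝓘(ℝ, E)) (n := ∞) (a := g)).mdifferentiable (by simp) 1
  have hch : MDifferentiableAt 𝓘(ℝ, E) 𝓘(ℝ, E) (unitChart E G) g :=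
    (contMDiffAt_unitChart hgs).mdifferentiableAt (by simp)
  have e1 := mfderiv_chain (x := (1 : G)) (y := g) hch hmul (mul_one g)
  have hcomp : MDifferentiableAt 𝓘(ℝ, E) 𝓘(ℝ, E) (unitChart E G ∘ fun h : G => g * h) 1 :=
    MDifferentiableAt.comp_of_eq 1 hch hmul (mul_one g)
  rw [modelDeriv_eq_fderiv hcomp rfl] at e1
  have e2 : HasFDerivAt (fun y => inUnitChart E (fun g h : G => g * h) (x, y))
      ((fderiv ℝ (inUnitChart E (fun g h : G => g * h)) (x, unitChart E G 1)).comp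
      (ContinuousLinearMap.inr ℝ E E)) (unitChart E G 1) :=
    HasFDerivAt.comp (f := fun y : E => (x, y)) _ hd.hasFDerivAt (hasFDerivAt_prodMk_right _ _)
  rw [← e2.fderiv]
  exact (DFunLike.congr_fun e1 Y).symm

/-- The tangent space at the unit is the model space through this very chart, so `Ad` is the
derivative of conjugation as read in it. -/
theorem Ad_unitChart_symm {x : E}
    (hd : DifferentiableAt ℝ (inUnitChart E (fun g h : G => g * h * g⁻¹)) (x, unitChart E G 1)) :
    Ad E ((unitChart E G).symm x) =
    (fderiv ℝ (inUnitChart E (fun g h : G => g * h * g⁻¹)) (x, unitChart E G 1)).comp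
      (ContinuousLinearMap.inr ℝ E E) := by
  have e2 : HasFDerivAt (fun y => inUnitChart E (fun g h : G => g * h * g⁻¹) (x, y))
      ((fderiv ℝ (inUnitChart E (fun g h : G => g * h * g⁻¹)) (x, unitChart E G 1)).comp
      (ContinuousLinearMap.inr ℝ E E)) (unitChart E G 1) :=
    HasFDerivAt.comp (f := fun y : E => (x, y)) _ hd.hasFDerivAt (hasFDerivAt_prodMk_right _ _)
  rw [← e2.fderiv]
  exact modelDeriv_eq_fderiv
    ((contMDiff_conj E ((unitChart E G).symm x)).mdifferentiable (by simp) 1) (by simp)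

end AdDeriv

/-! ### The derivative of `Ad` at the unit is the bracket -/

section AdDeriv

open Filter Topology

variable {E : Type*} [NormedAddCommGroup E] [NormedSpace ℝ E]
  {G : Type*} [TopologicalSpace G] [ChartedSpace E G] [Group G] [LieGroup 𝓘(ℝ, E) ∞ G]

theorem two_le_infty : (2 : ℕ∞ω) ≤ ∞ := WithTop.coe_le_coe.2 le_top

variable (E G) in
theorem contDiffAt_chartMul :
    ContDiffAt ℝ ∞ (inUnitChart E (fun g h : G => g * h)) (unitChart E G 1, unitChart E G 1) :=
  contDiffAt_inUnitChart_unit contMDiff_uncurry_mul (mul_one 1)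

variable (E G) in
theorem contDiffAt_chartConj :
    ContDiffAt ℝ ∞ (inUnitChart E (fun g h : G => g * h * g⁻¹))
      (unitChart E G 1, unitChart E G 1) :=
  contDiffAt_inUnitChart_unit contMDiff_uncurry_conj (by simp)

theorem ContDiffAt.eventually_differentiableAt_slice {F : E × E → E} {e : E}
    (hF : ContDiffAt ℝ ∞ F (e, e)) : ∀ᶠ x in 𝓝 e, DifferentiableAt ℝ F (x, e) := by
  have h : ∀ᶠ z in 𝓝 (e, e), ContDiffAt ℝ 1 F z := (hF.of_le (by simp)).eventually (by simp)
  have ht : Tendsto (fun x : E => (x, e)) (𝓝 e) (𝓝 (e, e)) :=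
    (continuous_id.prodMk continuous_const).continuousAt
  exact (ht.eventually h).mono fun x hx => hx.differentiableAt (by simp)

theorem Ad_eventuallyEq :
    (Ad E : G → LieAlg E G →L[ℝ] LieAlg E G) =ᶠ[𝓝 1]
      fun g => (fderiv ℝ (inUnitChart E (fun g h : G => g * h * g⁻¹))
        (unitChart E G g, unitChart E G 1)).comp (ContinuousLinearMap.inr ℝ E E) := by
  have hc : Tendsto (unitChart E G) (𝓝 1) (𝓝 (unitChart E G 1)) :=
    continuousAt_extChartAt (1 : G)
  filter_upwards [extChartAt_source_mem_nhds (I := 𝓘(ℝ, E)) (1 : G),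
    hc.eventually (contDiffAt_chartConj E G).eventually_differentiableAt_slice] with g hg hd
  have := Ad_unitChart_symm hd
  rw [(unitChart E G).left_inv hg] at this
  exact this

variable (E G) in
theorem differentiableAt_chart_Ad :
    DifferentiableAt ℝ (fun x => (fderiv ℝ (inUnitChart E (fun g h : G => g * h * g⁻¹))
        (x, unitChart E G 1)).comp (ContinuousLinearMap.inr ℝ E E)) (unitChart E G 1) :=
  (hasFDerivAt_partial_deriv ((contDiffAt_chartConj E G).of_le two_le_infty) _ _
    (hasFDerivAt_prodMk_left _ _) rfl).differentiableAt

variable (E G) in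
theorem mdifferentiableAt_Ad_one :
    MDifferentiableAt 𝓘(ℝ, E) 𝓘(ℝ, LieAlg E G →L[ℝ] LieAlg E G) (Ad E : G → _) 1 := by
  refine MDifferentiableAt.congr_of_eventuallyEq ?_ Ad_eventuallyEq
  exact MDifferentiableAt.comp (I' := 𝓘(ℝ, E)) (1 : G) (differentiableAt_chart_Ad E G).mdifferentiableAt
    ((contMDiffAt_unitChart (mem_extChartAt_source (1 : G))).mdifferentiableAt (by simp))

theorem modelDeriv_Ad_eq (X : E) :
    modelDeriv E (LieAlg E G →L[ℝ] LieAlg E G) (Ad E : G → _) 1 X =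
      fderiv ℝ (fun x => (fderiv ℝ (inUnitChart E (fun g h : G => g * h * g⁻¹))
        (x, unitChart E G 1)).comp (ContinuousLinearMap.inr ℝ E E)) (unitChart E G 1) X := by
  rw [modelDeriv_eq_fderiv (mdifferentiableAt_Ad_one E G) rfl]
  have : (extChartAt 𝓘(ℝ, LieAlg E G →L[ℝ] LieAlg E G) (Ad E (1 : G)) ∘ (Ad E : G → _) ∘
      (unitChart E G).symm) =ᶠ[𝓝 (unitChart E G 1)]
      (fun x => (fderiv ℝ (inUnitChart E (fun g h : G => g * h * g⁻¹))
        (x, unitChart E G 1)).comp (ContinuousLinearMap.inr ℝ E E)) := by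
    filter_upwards [(contDiffAt_chartConj E G).eventually_differentiableAt_slice] with x hx
    exact Ad_unitChart_symm hx
  exact DFunLike.congr_fun this.fderiv_eq X

variable (E G) in
-- This is `xy = (x y x⁻¹) x`; it holds only near the unit because the conjugate has to stay in the
-- domain of the chart.
theorem eventually_chartMul_eq :
    ∀ᶠ z in 𝓝 (unitChart E G 1, unitChart E G 1), inUnitChart E (fun g h : G => g * h) z =
      inUnitChart E (fun g h : G => g * h)
        (inUnitChart E (fun g h : G => g * h * g⁻¹) z, z.1) := by
  have hs : Tendsto (unitChart E G).symm (𝓝 (unitChart E G 1)) (𝓝 (1 : G)) := by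
    have := (contMDiffAt_unitChart_symm (E := E) (G := G) (mem_extChartAt_target (1 : G))).continuousAt
    rw [ContinuousAt, unitChart_symm_unit] at this
    exact this
  have h : Tendsto (fun z : E × E => (unitChart E G).symm z.1 * (unitChart E G).symm z.2 *
      ((unitChart E G).symm z.1)⁻¹) (𝓝 (unitChart E G 1, unitChart E G 1)) (𝓝 (1 : G)) := by
    have hT := (contMDiff_uncurry_conj (E := E) (G := G)).continuous.tendsto (1, 1)
    simp only [mul_one, inv_one] at hT
    rw [nhds_prod_eq]
    rw [nhds_prod_eq] at hT
    exact hT.comp ((hs.comp tendsto_fst).prodMk (hs.comp tendsto_snd))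
  filter_upwards [h.eventually (extChartAt_source_mem_nhds (I := 𝓘(ℝ, E)) (1 : G))] with z hz
  simp only [inUnitChart]
  rw [(unitChart E G).left_inv hz, inv_mul_cancel_right]

theorem chartMul_unit_right {x : E} (hx : x ∈ (unitChart E G).target) :
    inUnitChart E (fun g h : G => g * h) (x, unitChart E G 1) = x := by
  simp only [inUnitChart, unitChart_symm_unit, mul_one, (unitChart E G).right_inv hx]

theorem chartMul_unit_left {x : E} (hx : x ∈ (unitChart E G).target) :
    inUnitChart E (fun g h : G => g * h) (unitChart E G 1, x) = x := by
  simp only [inUnitChart, unitChart_symm_unit, one_mul, (unitChart E G).right_inv hx]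

theorem chartConj_unit_left {x : E} (hx : x ∈ (unitChart E G).target) :
    inUnitChart E (fun g h : G => g * h * g⁻¹) (unitChart E G 1, x) = x := by
  simp only [inUnitChart, unitChart_symm_unit, one_mul, inv_one, mul_one,
    (unitChart E G).right_inv hx]

theorem chartConj_unit_right (x : E) :
    inUnitChart E (fun g h : G => g * h * g⁻¹) (x, unitChart E G 1) = unitChart E G 1 := by
  simp only [inUnitChart, unitChart_symm_unit, mul_one, mul_inv_cancel]

/-- The bracket on a manifold is the bracket in the chart, transported by the derivative of the
chart at its own centre, and that derivative is the identity. -/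
theorem mlieBracket_eq_lieBracket {M : Type*} [TopologicalSpace M] [ChartedSpace E M]
    [IsManifold 𝓘(ℝ, E) 1 M] (V W : ∀ x : M, TangentSpace 𝓘(ℝ, E) x) (x : M) :
    VectorField.mlieBracket 𝓘(ℝ, E) V W x =
      VectorField.lieBracket ℝ
        (VectorField.mpullbackWithin 𝓘(ℝ, E) 𝓘(ℝ, E) (extChartAt 𝓘(ℝ, E) x).symm V
          (Set.range 𝓘(ℝ, E)))
        (VectorField.mpullbackWithin 𝓘(ℝ, E) 𝓘(ℝ, E) (extChartAt 𝓘(ℝ, E) x).symm W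
          (Set.range 𝓘(ℝ, E))) (extChartAt 𝓘(ℝ, E) x x) := by
  have aux : ∀ (T : E →L[ℝ] E) (v : E), T = ContinuousLinearMap.id ℝ E → T.inverse v = v := by
    rintro T v rfl
    rw [ContinuousLinearMap.inverse_id]
    rfl
  have hs : (extChartAt 𝓘(ℝ, E) x).symm ⁻¹' Set.univ ∩ Set.range 𝓘(ℝ, E) = Set.univ := by
    rw [Set.preimage_univ, Set.univ_inter, ModelWithCorners.range_eq_univ]
  have aux' : ∀ (V W : E → E) (s : Set E) (y : E), s = Set.univ →
      VectorField.lieBracketWithin ℝ V W s y = VectorField.lieBracket ℝ V W y := by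
    rintro V W s y rfl
    rw [VectorField.lieBracketWithin_univ]
  exact (aux _ _ mfderiv_extChartAt_self).trans (aux' _ _ _ _ hs)

variable [FiniteDimensional ℝ E]

/-- In the chart the left invariant field of `Z` is `x ↦ ∂₂μ(x, e) Z`, with value `Z` at the unit.
The formula is the vector field bracket `DW(V) - DV(W)` of two such fields. -/
theorem lie_eq_fderiv (X Y : LieAlg E G) :
    ⁅X, Y⁆ =
      fderiv ℝ (fun x => (fderiv ℝ (inUnitChart E (fun g h : G => g * h))
        (x, unitChart E G 1)).comp (ContinuousLinearMap.inr ℝ E E)) (unitChart E G 1) X Y -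
      fderiv ℝ (fun x => (fderiv ℝ (inUnitChart E (fun g h : G => g * h))
        (x, unitChart E G 1)).comp (ContinuousLinearMap.inr ℝ E E)) (unitChart E G 1) Y X := by
  have := isManifold_lieGroup E G
  have hd := (contDiffAt_chartMul E G).eventually_differentiableAt_slice
  have hV : ∀ Z : LieAlg E G, VectorField.mpullbackWithin 𝓘(ℝ, E) 𝓘(ℝ, E) (unitChart E G).symm
      (mulInvariantVectorField Z.tan) (Set.range 𝓘(ℝ, E)) =ᶠ[𝓝 (unitChart E G 1)]
      fun x => (fderiv ℝ (inUnitChart E (fun g h : G => g * h)) (x, unitChart E G 1)).comp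
        (ContinuousLinearMap.inr ℝ E E) Z := by
    intro Z
    filter_upwards [eventually_mem_unitChart_target (E := E) (G := G), hd] with x hx hdx
    exact mpullbackWithin_mulInvariantVectorField Z.tan hx hdx
  have hone : (fderiv ℝ (inUnitChart E (fun g h : G => g * h))
      (unitChart E G 1, unitChart E G 1)).comp (ContinuousLinearMap.inr ℝ E E) =
      ContinuousLinearMap.id ℝ E := by
    have h := HasFDerivAt.comp (f := fun x : E => (unitChart E G 1, x)) (unitChart E G 1)
      ((contDiffAt_chartMul E G).differentiableAt (by simp)).hasFDerivAt
      (hasFDerivAt_prodMk_right _ _)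
    refine h.unique ((hasFDerivAt_id _).congr_of_eventuallyEq ?_)
    exact eventually_mem_unitChart_target.mono fun x hx => chartMul_unit_left hx
  have hD : ∀ Z : E, HasFDerivAt (fun x => (fderiv ℝ (inUnitChart E (fun g h : G => g * h))
      (x, unitChart E G 1)).comp (ContinuousLinearMap.inr ℝ E E) Z)
      ((fderiv ℝ (fun x => (fderiv ℝ (inUnitChart E (fun g h : G => g * h))
        (x, unitChart E G 1)).comp (ContinuousLinearMap.inr ℝ E E)) (unitChart E G 1)).flip Z)
      (unitChart E G 1) := by
    intro Z
    have h := (hasFDerivAt_partial_deriv ((contDiffAt_chartMul E G).of_le two_le_infty)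
      (ContinuousLinearMap.inr ℝ E E) _ (hasFDerivAt_prodMk_left _ _) rfl).differentiableAt
    exact (ContinuousLinearMap.apply ℝ E Z).hasFDerivAt.comp _ h.hasFDerivAt
  have hv := fun Z : LieAlg E G => (hV Z).fderiv_eq.trans (hD Z).fderiv
  have hv0 : ∀ Z : LieAlg E G, VectorField.mpullbackWithin 𝓘(ℝ, E) 𝓘(ℝ, E) (unitChart E G).symm
      (mulInvariantVectorField Z.tan) (Set.range 𝓘(ℝ, E)) (unitChart E G 1) = Z :=
    fun Z => (hV Z).self_of_nhds.trans (DFunLike.congr_fun hone Z)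
  have : IsManifold 𝓘(ℝ, E) 1 G := IsManifold.of_le (n := ∞) (by simp)
  refine (mlieBracket_eq_lieBracket (mulInvariantVectorField X.tan)
    (mulInvariantVectorField Y.tan) (1 : G)).trans ?_
  have e := fun Z Z' : LieAlg E G =>
    congrArg₂ (fun (T : E →L[ℝ] E) v => T v) (hv Z') (hv0 Z)
  exact congrArg₂ (fun v w : E => v - w) (e X Y) (e Y X)

/-- The derivative of the adjoint representation at the unit is the bracket. -/
theorem modelDeriv_Ad (X Y : LieAlg E G) :
    modelDeriv E (LieAlg E G →L[ℝ] LieAlg E G) (Ad E : G → _) 1 X Y = ⁅X, Y⁆ := by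
  rw [lie_eq_fderiv]
  exact (DFunLike.congr_fun (modelDeriv_Ad_eq (E := E) (G := G) X) Y).trans
    (fderiv_partial_conj ((contDiffAt_chartMul E G).of_le two_le_infty)
      ((contDiffAt_chartConj E G).of_le two_le_infty)
      (eventually_mem_unitChart_target.mono fun x hx => chartMul_unit_right hx)
      (Eventually.of_forall chartConj_unit_right)
      (eventually_mem_unitChart_target.mono fun x hx => chartConj_unit_left hx)
      (eventually_chartMul_eq E G) X Y)

end AdDeriv

/-! ### Infinitesimal representations and the Lie algebra of `P` -/

section Infinitesimal

variable {E : Type*} [NormedAddCommGroup E] [NormedSpace ℝ E] {M : Type*} [TopologicalSpace M]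
  [ChartedSpace E M]

theorem modelDeriv_clm_comp {V W : Type*} [NormedAddCommGroup V] [NormedSpace ℝ V]
    [NormedAddCommGroup W] [NormedSpace ℝ W] (K : V →L[ℝ] W) {f : M → V} {x : M}
    (hf : MDifferentiableAt 𝓘(ℝ, E) 𝓘(ℝ, V) f x) (Y : E) :
    modelDeriv E W (fun y => K (f y)) x Y = K (modelDeriv E V f x Y) := by
  have h := mfderiv_chain (k := K) K.differentiableAt.mdifferentiableAt hf rfl
  rw [modelDeriv_clm] at h
  exact DFunLike.congr_fun h Y

variable {G : Type*} [TopologicalSpace G] [ChartedSpace E G] [Group G] [LieGroup 𝓘(ℝ, E) ∞ G]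
  {𝕜 : Type*} [RCLike 𝕜] {V : Type*} [NormedAddCommGroup V] [NormedSpace ℝ V] [Module 𝕜 V]
  [IsScalarTower ℝ 𝕜 V] [FiniteDimensional ℝ V] {ρ : Representation 𝕜 G V}

/-- Differentiate `ρ(g x g⁻¹) = ρ(g) ρ(x) ρ(g⁻¹)` at `x = 1`. -/
theorem realRep_infRep (hρ : IsSmoothRep E ρ) (g : G) (Y : LieAlg E G) (v : V) :
    realRep ρ g (infRep E ρ Y v) = infRep E ρ (Ad E g Y) (realRep ρ g v) := by
  have hrep := fun g : G => hρ.mdifferentiable (by simp) g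
  have hconj : MDifferentiableAt 𝓘(ℝ, E) 𝓘(ℝ, E) (fun x : G => g * x * g⁻¹) 1 :=
    (contMDiff_conj E g).mdifferentiable (by simp) 1
  have e1 := mfderiv_chain (x := (1 : G)) (y := (1 : G)) (hrep 1) hconj (by simp)
  let K := (ContinuousLinearMap.compL ℝ V V V (realRep ρ g)).comp
    ((ContinuousLinearMap.compL ℝ V V V).flip (realRep ρ g⁻¹))
  have hK : (realRep ρ ∘ fun x : G => g * x * g⁻¹) = fun x => K (realRep ρ x) := by
    ext x v
    simp [K]
  have e2 := modelDeriv_clm_comp K (hrep 1) Y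
  rw [← hK, e1] at e2
  have e3 := DFunLike.congr_fun e2 (realRep ρ g v)
  have e4 : realRep ρ g⁻¹ (realRep ρ g v) = v := by
    change (realRep ρ g⁻¹ * realRep ρ g) v = v
    rw [← map_mul]
    simp
  have e5 : K (infRep E ρ Y) (realRep ρ g v) = realRep ρ g (infRep E ρ Y v) :=
    congrArg (fun w => realRep ρ g (infRep E ρ Y w)) e4
  exact e5.symm.trans e3.symm

variable [FiniteDimensional ℝ E]

/-- The infinitesimal representation is a homomorphism of Lie algebras. -/
theorem infRep_lie (hρ : IsSmoothRep E ρ) (X Y : LieAlg E G) (v : V) :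
    infRep E ρ ⁅X, Y⁆ v = infRep E ρ X (infRep E ρ Y v) - infRep E ρ Y (infRep E ρ X v) := by
  have hrep : MDifferentiableAt 𝓘(ℝ, E) 𝓘(ℝ, V →L[ℝ] V) (realRep ρ) (1 : G) :=
    hρ.mdifferentiable (by simp) 1
  have hAd := mdifferentiableAt_Ad_one E G
  let K := (infRep E ρ).comp (ContinuousLinearMap.apply ℝ (LieAlg E G) Y)
  have hKd : MDifferentiableAt 𝓘(ℝ, E) 𝓘(ℝ, V →L[ℝ] V) (fun g : G => K (Ad E g)) 1 :=
    MDifferentiableAt.comp_of_eq 1 K.differentiableAt.mdifferentiableAt hAd rfl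
  have hv : MDifferentiableAt 𝓘(ℝ, E) 𝓘(ℝ, V)
      (fun g : G => ContinuousLinearMap.apply ℝ V v (realRep ρ g)) 1 :=
    MDifferentiableAt.comp_of_eq 1
      (ContinuousLinearMap.apply ℝ V v).differentiableAt.mdifferentiableAt hrep rfl
  have e1 := modelDeriv_clm_comp (ContinuousLinearMap.apply ℝ V (infRep E ρ Y v)) hrep X
  have e2 := mfderiv_clm_apply hKd hv X
  -- The identity `ρ(g)(Y·v) = (Ad g Y)·ρ(g)v` is differentiated at `g = 1` along `X`; the product
  -- rule on the right gives `[X, Y]·v + Y·X·v`.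
  have e : (fun g : G => ContinuousLinearMap.apply ℝ V (infRep E ρ Y v) (realRep ρ g)) =
      fun g => K (Ad E g) (ContinuousLinearMap.apply ℝ V v (realRep ρ g)) := by
    ext g
    exact realRep_infRep hρ g Y v
  have e3 : modelDeriv E (V →L[ℝ] V) (fun g : G => K (Ad E g)) 1 X = infRep E ρ ⁅X, Y⁆ :=
    (modelDeriv_clm_comp K hAd X).trans (congrArg (infRep E ρ) (modelDeriv_Ad X Y))
  have e4 : modelDeriv E V (fun g : G => ContinuousLinearMap.apply ℝ V v (realRep ρ g)) 1 X =
      infRep E ρ X v := modelDeriv_clm_comp (ContinuousLinearMap.apply ℝ V v) hrep X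
  have e5 : infRep E ρ ⁅X, Y⁆ v + infRep E ρ Y (infRep E ρ X v) =
      infRep E ρ X (infRep E ρ Y v) := by
    rw [e, e2, e3, e4] at e1
    simp [K, Ad_one, map_one] at e1
    exact e1
  exact eq_sub_of_add_eq e5

variable {P : Subgroup G} {EP : Type*} [NormedAddCommGroup EP] [NormedSpace ℝ EP]
  [FiniteDimensional ℝ EP] [ChartedSpace EP P] [LieGroup 𝓘(ℝ, EP) ∞ P]

theorem Ad_mem_lieSub
    (hP : MDifferentiableAt 𝓘(ℝ, EP) 𝓘(ℝ, E) (Subtype.val : P → G) 1) (h : P) {Y : LieAlg E G}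
    (hY : Y ∈ lieSub E P EP) : Ad E (h : G) Y ∈ lieSub E P EP := by
  obtain ⟨y, rfl⟩ := hY
  have hconj : MDifferentiableAt 𝓘(ℝ, E) 𝓘(ℝ, E) (fun x : G => (h : G) * x * (h : G)⁻¹) 1 :=
    (contMDiff_conj E (h : G)).mdifferentiable (by simp) 1
  have hconj' : MDifferentiableAt 𝓘(ℝ, EP) 𝓘(ℝ, EP) (fun x : P => h * x * h⁻¹) 1 :=
    (contMDiff_conj EP h).mdifferentiable (by simp) 1
  have e1 := mfderiv_chain (x := (1 : P)) (y := (1 : G)) hconj hP rfl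
  have e2 := mfderiv_chain (x := (1 : P)) (y := (1 : P)) hP hconj' (by simp)
  have e : (fun x : G => (h : G) * x * (h : G)⁻¹) ∘ (Subtype.val : P → G) =
      (Subtype.val : P → G) ∘ fun x : P => h * x * h⁻¹ := by
    ext x
    simp
  rw [e, e2] at e1
  exact ⟨modelDeriv EP EP (fun x : P => h * x * h⁻¹) 1 y, DFunLike.congr_fun e1 y⟩

/-- The derivative at `1` of the restriction to `P` of the adjoint representation. -/
theorem modelDeriv_Ad_val
    (hP : MDifferentiableAt 𝓘(ℝ, EP) 𝓘(ℝ, E) (Subtype.val : P → G) 1) {W : Type*}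
    [NormedAddCommGroup W] [NormedSpace ℝ W] (f : LieAlg E G →L[ℝ] W) (z : EP) (Y : LieAlg E G) :
    modelDeriv EP W (fun h : P => f (Ad E (h : G) Y)) 1 z = f ⁅lieIncl E P EP z, Y⁆ := by
  have hAd := mdifferentiableAt_Ad_one E G
  have hc : MDifferentiableAt 𝓘(ℝ, EP) 𝓘(ℝ, LieAlg E G →L[ℝ] LieAlg E G)
      ((Ad E : G → _) ∘ (Subtype.val : P → G)) 1 :=
    MDifferentiableAt.comp_of_eq 1 hAd hP rfl
  have e1 := mfderiv_chain (x := (1 : P)) (y := (1 : G)) hAd hP rfl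
  have e2 := modelDeriv_clm_comp (f.comp (ContinuousLinearMap.apply ℝ (LieAlg E G) Y)) hc z
  rw [e1] at e2
  exact e2.trans (congrArg f (modelDeriv_Ad (lieIncl E P EP z) Y))

theorem lie_mem_lieSub
    (hP : MDifferentiableAt 𝓘(ℝ, EP) 𝓘(ℝ, E) (Subtype.val : P → G) 1) (Z : LieAlg E G)
    (hZ : Z ∈ lieSub E P EP) (Y : LieAlg E G) (hY : Y ∈ lieSub E P EP) :
    ⁅Z, Y⁆ ∈ lieSub E P EP := by
  obtain ⟨z, rfl⟩ := hZ
  by_contra hn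
  -- A functional that kills `𝔭` but not the bracket would vanish along `h ↦ Ad h Y`, whose
  -- derivative at `1` is the bracket.
  obtain ⟨f, hf, hf0⟩ := Submodule.exists_le_ker_of_notMem hn
  have e := modelDeriv_Ad_val hP (LinearMap.toContinuousLinearMap f) z Y
  have hc : (fun h : P => LinearMap.toContinuousLinearMap f (Ad E (h : G) Y)) = fun _ => 0 := by
    ext h
    exact hf0 (Ad_mem_lieSub hP h hY)
  rw [hc, modelDeriv_const] at e
  exact hf e.symm

end Infinitesimal

/-! ### Vertical derivatives of `Dσ` and the curved Casimir formula -/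

section Main

variable {EG : Type*} [NormedAddCommGroup EG] [NormedSpace ℝ EG] [FiniteDimensional ℝ EG]
  {G : Type*} [TopologicalSpace G] [ChartedSpace EG G] [Group G] [LieGroup 𝓘(ℝ, EG) ∞ G]
  {P : Subgroup G} {EP : Type*} [NormedAddCommGroup EP] [NormedSpace ℝ EP]
  [FiniteDimensional ℝ EP] [ChartedSpace EP P] [LieGroup 𝓘(ℝ, EP) ∞ P]
  {EB : Type*} [NormedAddCommGroup EB] [NormedSpace ℝ EB] [FiniteDimensional ℝ EB]
  {B : Type*} [TopologicalSpace B] [ChartedSpace EB B] [IsManifold 𝓘(ℝ, EB) ∞ B]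
  {EM : Type*} [NormedAddCommGroup EM] [NormedSpace ℝ EM] [FiniteDimensional ℝ EM]
  {M : Type*} [TopologicalSpace M] [ChartedSpace EM M] [IsManifold 𝓘(ℝ, EM) ∞ M]
  {𝕜 : Type*} [RCLike 𝕜] {V : Type*} [NormedAddCommGroup V] [NormedSpace ℝ V] [Module 𝕜 V]
  [IsScalarTower ℝ 𝕜 V] [FiniteDimensional ℝ V]
  {geo : CartanGeometry EG EP P EB B EM M} {ρ : Representation 𝕜 G V}

theorem IsParabolicSubgroup.mdifferentiableAt_val (hP : IsParabolicSubgroup EG P EP) :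
    MDifferentiableAt 𝓘(ℝ, EP) 𝓘(ℝ, EG) (Subtype.val : P → G) 1 :=
  hP.isSmoothEmbedding.contMDiff.mdifferentiable (by simp) 1

theorem constDeriv_clm_comp {W W' : Type*} [NormedAddCommGroup W] [NormedSpace ℝ W]
    [NormedAddCommGroup W'] [NormedSpace ℝ W'] (K : W →L[ℝ] W') {f : B → W} {u : B}
    (hf : MDifferentiableAt 𝓘(ℝ, EB) 𝓘(ℝ, W) f u) (X : LieAlg EG G) :
    constDeriv geo (fun w => K (f w)) u X = K (constDeriv geo f u X) :=
  modelDeriv_clm_comp K hf _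

/-- The derivative along the orbit map of the vertical vector `conn_u⁻¹(Z)`, `Z ∈ 𝔭`. -/
theorem modelDeriv_comp_act {W : Type*} [NormedAddCommGroup W] [NormedSpace ℝ W] {f : B → W} {u : B}
    (hf : MDifferentiableAt 𝓘(ℝ, EB) 𝓘(ℝ, W) f u) (z : EP) :
    modelDeriv EP W (f ∘ geo.act u) 1 z = constDeriv geo f u (lieIncl EG P EP z) := by
  have hact : MDifferentiableAt 𝓘(ℝ, EP) 𝓘(ℝ, EB) (geo.act u) 1 :=
    (geo.smooth_act.comp (contMDiff_const.prodMk contMDiff_id)).mdifferentiable (by simp) 1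
  have e := mfderiv_chain hf hact (geo.act_one u)
  -- `conn_fundamental` is stated at `act u 1`, which is only provably equal to `u`.
  have aux : ∀ w, w = u → ∀ ξ : EB, geo.conn w ξ = geo.conn u ξ := by
    rintro _ rfl _; rfl
  have hcf : (geo.conn u).symm (lieIncl EG P EP z) = modelDeriv EP EB (geo.act u) 1 z :=
    (geo.conn u).symm_apply_eq.2
      ((geo.conn_fundamental u z).symm.trans (aux _ (geo.act_one u) _))
  exact (DFunLike.congr_fun e z).trans (congrArg (modelDeriv EB W f u) hcf.symm)

/-- The second fundamental derivative in vertical directions: `D_Z D_X σ = -Z · D_X σ + D_[Z,X] σ`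
for `Z ∈ 𝔭`. -/
theorem constDeriv_fundDeriv_of_mem_left (hP : IsParabolicSubgroup EG P EP)
    (hρ : IsSmoothRep EG ρ) (σ : NatSection geo (resRep P ρ)) (u : B) {Z : LieAlg EG G}
    (hZ : Z ∈ lieSub EG P EP) (X : LieAlg EG G) :
    constDeriv geo (fundDeriv σ).toFun u Z X =
      -(infRep EG ρ Z (constDeriv geo σ.toFun u X)) + constDeriv geo σ.toFun u ⁅Z, X⁆ := by
  obtain ⟨z, rfl⟩ := hZ
  have hval := hP.mdifferentiableAt_val
  have hact : MDifferentiableAt 𝓘(ℝ, EP) 𝓘(ℝ, EB) (geo.act u) 1 :=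
    (geo.smooth_act.comp (contMDiff_const.prodMk contMDiff_id)).mdifferentiable (by simp) 1
  have hD : MDifferentiableAt 𝓘(ℝ, EB) 𝓘(ℝ, LieAlg EG G →L[ℝ] V) (fundDeriv σ).toFun u :=
    (fundDeriv σ).smooth.mdifferentiable (by simp) u
  have hDX : MDifferentiableAt 𝓘(ℝ, EB) 𝓘(ℝ, V)
      (fun w => ContinuousLinearMap.apply ℝ V X ((fundDeriv σ).toFun w)) u :=
    MDifferentiableAt.comp_of_eq u
      (ContinuousLinearMap.apply ℝ V X).differentiableAt.mdifferentiableAt hD rfl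
  have hrep : MDifferentiableAt 𝓘(ℝ, EG) 𝓘(ℝ, V →L[ℝ] V) (realRep ρ) 1 :=
    hρ.mdifferentiable (by simp) 1
  have hA : MDifferentiableAt 𝓘(ℝ, EP) 𝓘(ℝ, V →L[ℝ] V) (realRep ρ ∘ (Subtype.val : P → G)) 1 :=
    MDifferentiableAt.comp_of_eq 1 hrep hval rfl
  have hS : MDifferentiableAt 𝓘(ℝ, EP) 𝓘(ℝ, V)
      ((fun w => ContinuousLinearMap.apply ℝ V X ((fundDeriv σ).toFun w)) ∘ geo.act u) 1 :=
    MDifferentiableAt.comp_of_eq 1 hDX hact (geo.act_one u)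
  have prod := mfderiv_clm_apply hA hS z
  -- Equivariance of `Dσ` in the form `h·(Dσ(u h)(X)) = Dσ(u)(Ad h X)`. At `h = 1` the left side
  -- differentiates to `Z·D_X σ + D_Z D_X σ`, the right side to `D_[Z,X] σ`.
  have hfun : (fun h => (realRep ρ ∘ (Subtype.val : P → G)) h
      (((fun w => ContinuousLinearMap.apply ℝ V X ((fundDeriv σ).toFun w)) ∘ geo.act u) h)) =
      fun h : P => (fundDeriv σ).toFun u (Ad EG (h : G) X) := by
    ext h
    have h1 := DFunLike.congr_fun ((fundDeriv σ).equivariant u h) X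
    rw [homRep_apply] at h1
    have h2 : ∀ v, realRep ρ (h : G) (resRep P ρ h⁻¹ v) = v := by
      intro v
      change (realRep ρ (h : G) * realRep ρ ((h⁻¹ : P) : G)) v = v
      rw [← map_mul]
      simp
    refine (congrArg (realRep ρ (h : G)) h1).trans ((h2 _).trans ?_)
    simp
  rw [hfun, modelDeriv_Ad_val hval, mfderiv_chain hrep hval rfl, modelDeriv_comp_act hDX,
    constDeriv_clm_comp _ hD] at prod
  have h0 : ((realRep ρ ∘ (Subtype.val : P → G)) 1 : V →L[ℝ] V) = 1 := by simp
  have hs1 : ((fun w => ContinuousLinearMap.apply ℝ V X ((fundDeriv σ).toFun w)) ∘ geo.act u) 1 =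
      constDeriv geo σ.toFun u X := by
    simp only [Function.comp_apply, geo.act_one]
    rfl
  rw [h0, hs1] at prod
  have e : constDeriv geo σ.toFun u ⁅lieIncl EG P EP z, X⁆ =
      infRep EG ρ (lieIncl EG P EP z) (constDeriv geo σ.toFun u X) +
        constDeriv geo (fundDeriv σ).toFun u (lieIncl EG P EP z) X := prod
  change constDeriv geo (fundDeriv σ).toFun u (lieIncl EG P EP z) X =
    -(infRep EG ρ (lieIncl EG P EP z) (constDeriv geo σ.toFun u X)) +
      constDeriv geo σ.toFun u ⁅lieIncl EG P EP z, X⁆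
  rw [e]
  abel

/-- `D_X D_Y σ = -Y · D_X σ` for `Y ∈ 𝔭`. -/
theorem constDeriv_fundDeriv_of_mem_right (hP : IsParabolicSubgroup EG P EP)
    (hρ : IsSmoothRep EG ρ) (σ : NatSection geo (resRep P ρ)) (u : B) (X : LieAlg EG G)
    {Y : LieAlg EG G} (hY : Y ∈ lieSub EG P EP) :
    constDeriv geo (fundDeriv σ).toFun u X Y =
      -(infRep EG ρ Y (constDeriv geo σ.toFun u X)) := by
  have hD : MDifferentiableAt 𝓘(ℝ, EB) 𝓘(ℝ, LieAlg EG G →L[ℝ] V) (fundDeriv σ).toFun u :=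
    (fundDeriv σ).smooth.mdifferentiable (by simp) u
  have e1 := constDeriv_clm_comp (geo := geo) (ContinuousLinearMap.apply ℝ V Y) hD X
  have e2 := constDeriv_clm_comp (geo := geo) (-(infRep EG ρ Y))
    (σ.smooth.mdifferentiable (by simp) u) X
  -- `D_Y σ = -Y·σ` holds at every point of the bundle, so it may be differentiated along
  -- `conn⁻¹(X)`.
  have e : (fun w => ContinuousLinearMap.apply ℝ V Y ((fundDeriv σ).toFun w)) =
      fun w => (-(infRep EG ρ Y)) (σ.toFun w) :=
    funext fun w => constDeriv_of_mem hP hρ σ w hY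
  rw [e, e2] at e1
  exact e1.symm

variable [LieAlgebra.IsSemisimple ℝ (LieAlg EG G)]

theorem curvedCasimir_eq (hP : IsParabolicSubgroup EG P EP) (hρ : IsSmoothRep EG ρ)
    (σ : NatSection geo (resRep P ρ)) (u : B) :
    (curvedCasimir σ).toFun u = casimir EG ρ (σ.toFun u) +
      (2 : ℝ) • codifferential (lieSub EG P EP) ρ (tractorConnection hP hρ σ) u := by
  classical
  set p := lieSub EG P EP with hp
  let A := infRep EG ρ
  let s := σ.toFun u
  let D := (fundDeriv σ).toFun u
  let T := toBilin ((fundDeriv (fundDeriv σ)).toFun u)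
  let N : LieAlg EG G →ₗ[ℝ] V := (tractorConnection hP hρ σ u).comp p.mkQ
  have hN : ∀ X, N X = D X + A X s := fun X => rfl
  have hNp : ∀ X ∈ p, N X = 0 := fun X hX => by
    have : p.mkQ X = 0 := by simpa using hX
    rw [LinearMap.comp_apply, this, map_zero]
  let S : LieAlg EG G →ₗ[ℝ] LieAlg EG G →ₗ[ℝ] V :=
    LinearMap.mk₂ ℝ (fun X Y => T X Y + A Y (D X)) (fun _ _ _ => by simp; abel)
      (fun _ _ _ => by simp)
      (fun _ _ _ => by simp; abel) (fun _ _ _ => by simp)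
  let Q : LieAlg EG G →ₗ[ℝ] LieAlg EG G →ₗ[ℝ] V :=
    LinearMap.mk₂ ℝ (fun X Y => A X (N Y)) (fun _ _ _ => by simp) (fun _ _ _ => by simp)
      (fun _ _ _ => by simp) (fun _ _ _ => by simp)
  let R : LieAlg EG G →ₗ[ℝ] LieAlg EG G →ₗ[ℝ] V :=
    LinearMap.mk₂ ℝ (fun X Y => A X (A Y s)) (fun _ _ _ => by simp) (fun _ _ _ => by simp)
      (fun _ _ _ => by simp) (fun _ _ _ => by simp)
  -- `D_X D_Y σ = S(X, Y) - Y·D_X σ`, and `D_X σ = N(X) - X·s`.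
  have hT : killingContract T = killingContract S - killingContract Q.flip +
      killingContract R.flip := by
    simp only [killingContract, ← Finset.sum_sub_distrib, ← Finset.sum_add_distrib]
    refine Finset.sum_congr rfl fun i _ => ?_
    simp only [S, Q, R, LinearMap.flip_apply, LinearMap.mk₂_apply, hN, map_add]
    abel
  have hR : killingContract R.flip = casimir EG ρ s := killingContract_flip R
  obtain ⟨hpp, hpp'⟩ := hP.isParabolic.pPlus_le
  let b := Module.finBasis ℝ (pPlus p)
  obtain ⟨x, hδ, hx⟩ := exists_dual_frame p b
  have hS : ∀ X, ∀ Y ∈ p, S X Y = 0 := fun X Y hY => by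
    have : T X Y = -(A Y (D X)) := constDeriv_fundDeriv_of_mem_right hP hρ σ u X hY
    simp [S, this]
  -- With `D_Z σ = -Z·s`, the terms in `s` combine to `[Z, X]·s`, which completes `D_[Z,X] σ` to
  -- `N([Z, X])`.
  have hSl : ∀ Z ∈ p, ∀ X, S Z X = -(A Z (N X)) + N ⁅Z, X⁆ := by
    intro Z hZ X
    have h1 : T Z X = -(A Z (D X)) + D ⁅Z, X⁆ := constDeriv_fundDeriv_of_mem_left hP hρ σ u hZ X
    have h2 : D Z = -(A Z s) := constDeriv_of_mem hP hρ σ u hZ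
    have h3 : A ⁅Z, X⁆ s = A Z (A X s) - A X (A Z s) := infRep_lie hρ Z X s
    simp only [S, LinearMap.mk₂_apply, h1, h2, hN, h3, map_add, map_neg]
    abel
  have hzero : ∑ j, N ⁅(b j : LieAlg EG G), x j⁆ = 0 := by
    rw [← map_sum]
    exact hNp _ (sum_lie_dual_frame_mem (lie_mem_lieSub hP.mdifferentiableAt_val) hpp' hδ hx)
  have hcod : codifferential p ρ (tractorConnection hP hρ σ) u = -∑ j, A (b j) (N (x j)) := by
    rw [codifferential, pPlusTensorEquiv_symm_apply hx, map_sum, ← Finset.sum_neg_distrib]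
    exact Finset.sum_congr rfl fun j _ => kostantCodiff_tmul p ρ (b j) _
  have hC : (curvedCasimir σ).toFun u = killingContract T := rfl
  -- The factor `2`: `S` and `-Q` each contribute `-∑ b_j·N(x_j)`.
  rw [hC, hT, hR, killingContract_flip, killingContract_eq_sum_of_vanish hx S hS,
    killingContract_eq_sum_of_vanish hx Q fun X Y hY => by simp [Q, hNp Y hY], hcod,
    Finset.sum_congr rfl fun j _ => hSl (b j) (hpp (b j).2) (x j), Finset.sum_add_distrib, hzero,
    Finset.sum_neg_distrib, two_smul]
  simp only [Q, LinearMap.mk₂_apply]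
  abel

end Main

end

end CurvedCasimir

theorem proposition4p1
    {EG : Type*} [NormedAddCommGroup EG] [NormedSpace ℝ EG] [FiniteDimensional ℝ EG]
    {G : Type*} [TopologicalSpace G] [ChartedSpace EG G] [Group G] [LieGroup 𝓘(ℝ, EG) ∞ G]
    [LieAlgebra.IsSemisimple ℝ (LieAlg EG G)]
    {P : Subgroup G} {EP : Type*} [NormedAddCommGroup EP] [NormedSpace ℝ EP]
    [FiniteDimensional ℝ EP] [ChartedSpace EP P] [LieGroup 𝓘(ℝ, EP) ∞ P]
    (hP : IsParabolicSubgroup EG P EP)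
    {𝕜 : Type*} [RCLike 𝕜] {V : Type*} [NormedAddCommGroup V] [NormedSpace ℝ V] [Module 𝕜 V]
    [IsScalarTower ℝ 𝕜 V] [FiniteDimensional ℝ V]
    (ρ : Representation 𝕜 G V) (hρ : IsSmoothRep EG ρ) (hirr : ρ.IsIrreducible)
    (c₀ : 𝕜) (hc₀ : ∀ v : V, casimir EG ρ v = c₀ • v)
    {EB : Type*} [NormedAddCommGroup EB] [NormedSpace ℝ EB] [FiniteDimensional ℝ EB]
    {B : Type*} [TopologicalSpace B] [ChartedSpace EB B] [IsManifold 𝓘(ℝ, EB) ∞ B]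
    {EM : Type*} [NormedAddCommGroup EM] [NormedSpace ℝ EM] [FiniteDimensional ℝ EM]
    {M : Type*} [TopologicalSpace M] [ChartedSpace EM M] [IsManifold 𝓘(ℝ, EM) ∞ M]
    (geo : CartanGeometry EG EP P EB B EM M)
    (σ : NatSection geo (resRep P ρ)) (u : B) :
    (curvedCasimir σ).toFun u =
      c₀ • σ.toFun u +
        (2 : ℝ) • codifferential (lieSub EG P EP) ρ (tractorConnection hP hρ σ) u := by
  rw [curvedCasimir_eq hP hρ σ u, hc₀]
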